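/- Fix $0<p<1$ and $0<q<1$. For integers $N_1,N_2\ge 1$ let $\psi^+_{i,i'}=\psi^+_{i',i}$ ($1\le i\ne i'\le N_1$), $\psi^+_{j,j'}=\psi^+_{j',j}$ ($1\le j\ne j'\le N_2$) and $\psi^-_{i,j}=\psi^-_{j,i}$ ($1\le i\le N_1$, $1\le j\le N_2$) be time-independent random coefficients, mutually independent over the different (unordered) pairs, where each $\psi^+$ is $1$ with probability $p$ and $0$ with probability $1-p$, and each $\psi^-$ is $1$ with probability $q$ and $0$ with probability $1-q$. Consider, for $\mathbf x_i(t),\mathbf y_j(t)\in\mathbb R^d$ and $t\ge 0$, the system $$\dot{\mathbf x}_i=\frac1{N_1}\sum_{i'\ne i}\psi^+_{i,i'}(\mathbf x_{i'}-\mathbf x_i)-\frac1{N_2}\sum_j\psi^-_{i,j}(\mathbf y_j-\mathbf x_i),\qquad \dot{\mathbf y}_j=\frac1{N_2}\sum_{j'\ne j}\psi^+_{j,j'}(\mathbf y_{j'}-\mathbf y_j)-\frac1{N_1}\sum_i\psi^-_{j,i}(\mathbf x_i-\mathbf y_j).$$ Let $\bar{\mathbf x}=\frac1{N_1}\sum_i\mathbf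 x_i$, $\bar{\mathbf y}=\frac1{N_2}\sum_j\mathbf y_j$, $\hat{\mathbf x}_i=\mathbf x_i-\bar{\mathbf x}$, $\hat{\mathbf y}_j=\mathbf y_j-\bar{\mathbf y}$, $\mathrm{var}(\mathbf x)=\frac1{N_1}\sum_i|\hat{\mathbf x}_i|^2$, $\mathrm{var}(\mathbf y)=\frac1{N_2}\sum_j|\hat{\mathbf y}_j|^2$, and, whenever $\bar{\mathbf x}(t)\ne\bar{\mathbf y}(t)$, $$\lambda(t)=\frac{\mathrm{var}(\mathbf x(t))+\mathrm{var}(\mathbf y(t))}{|\bar{\mathbf x}(t)-\bar{\mathbf y}(t)|^2},\qquad \tilde\lambda(t)=\frac{\max_i|\hat{\mathbf x}_i(t)|^2+\max_j|\hat{\mathbf y}_j(t)|^2}{|\bar{\mathbf x}(t)-\bar{\mathbf y}(t)|^2}.$$ Let $\mu=p/2$ and $N=\min\{N_1,N_2\}$. There are constants $C(p,q,\alpha)>0$ and $c(p,q,\alpha)>0$ ($0<\alpha<1$) such that for every $\kappa>0$ there are a threshold $N_0$, a constant $K$ (both depending only on $p,q,\kappa$) and numbers $\lambda_-(N)>0$,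 $\lambda_+(N)$ with $$\lambda_-(N)\le\frac{C(p,q,\alpha)}{N^{1-\alpha}},\qquad \lambda_+(N)\ge c(p,q,\alpha)\,N^{1-\alpha}\qquad\text{for all } N\ge N_0 \text{ and all } 0<\alpha<1,$$ such that the following event has probability tending to $1$ as $N\to\infty$, uniformly over all $N_1,N_2$ with $\min\{N_1,N_2\}=N$ and $\frac1\kappa N_1\le N_2\le\kappa N_1$: for every $d$ and every solution of the system with $\bar{\mathbf x}(0)\ne\bar{\mathbf y}(0)$ and $\lambda(0)\le\lambda_+(N)$, one has for all $t\ge 0$ that $\bar{\mathbf x}(t)\ne\bar{\mathbf y}(t)$, $$\lambda(t)\le\lambda_-(N)+(\lambda(0)-\lambda_-(N))e^{-\mu t}\quad(L^2\text{ separation}),$$ $$\tilde\lambda(t)\le K\big(\lambda_-(N)+\tilde\lambda(0)e^{-\mu t}\big)\quad(L^\infty\text{ separation}).$$ -/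

import Mathlib

open MeasureTheory Filter Topology

noncomputable section

namespace Opinion

/-- Opinions of the members of a group of `n` people, as points of `ℝ^d`. -/
abbrev Config (d n : ℕ) : Type := Fin n → EuclideanSpace ℝ (Fin d)

/-- The mean location of a group, `(1/n) ∑ᵢ xᵢ`. -/
def mean {d n : ℕ} (x : Config d n) : EuclideanSpace ℝ (Fin d) :=
  (1 / (n : ℝ)) • ∑ i, x i

/-- The deviation `x̂ᵢ = xᵢ - x̄`. -/
def dev {d n : ℕ} (x : Config d n) (i : Fin n) : EuclideanSpace ℝ (Fin d) :=
  x i - mean x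

/-- The variance of a group, `(1/n) ∑ᵢ |x̂ᵢ|²`. -/
def variance {d n : ℕ} (x : Config d n) : ℝ :=
  (1 / (n : ℝ)) * ∑ i, ‖dev x i‖ ^ 2

/-- The largest squared deviation in a group, `maxᵢ |x̂ᵢ|²`. -/
def maxDev {d n : ℕ} (x : Config d n) : ℝ :=
  ⨆ i, ‖dev x i‖ ^ 2

/-- The `L²` ratio `λ = (var x + var y) / |x̄ - ȳ|²`. -/
def ratio {d N₁ N₂ : ℕ} (x : Config d N₁) (y : Config d N₂) : ℝ :=
  (variance x + variance y) / ‖mean x - mean y‖ ^ 2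

/-- The `L^∞` ratio `(maxᵢ |x̂ᵢ|² + maxⱼ |ŷⱼ|²) / |x̄ - ȳ|²`. -/
def maxRatio {d N₁ N₂ : ℕ} (x : Config d N₁) (y : Config d N₂) : ℝ :=
  (maxDev x + maxDev y) / ‖mean x - mean y‖ ^ 2

/-- The pairs of people that carry a communication coefficient: unordered pairs within the first
group, unordered pairs within the second group, and pairs with one member in each group.
(The diagonal elements `s(i, i)` carry an independent variable that never enters the dynamics.) -/
abbrev Link (N₁ N₂ : ℕ) : Type :=
  Sym2 (Fin N₁) ⊕ Sym2 (Fin N₂) ⊕ (Fin N₁ × Fin N₂)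

/-- A realization of the communication network: which pairs are communicating. -/
abbrev Network (N₁ N₂ : ℕ) : Type := Link N₁ N₂ → Bool

/-- The coefficient `0` or `1` of a pair. -/
def coeff {N₁ N₂ : ℕ} (ω : Network N₁ N₂) (e : Link N₁ N₂) : ℝ :=
  if ω e then 1 else 0

/-- The alignment coefficient `ψ⁺` of the members `i, i'` of the first group. -/
def alignX {N₁ N₂ : ℕ} (ω : Network N₁ N₂) (i i' : Fin N₁) : ℝ :=
  coeff ω (Sum.inl s(i, i'))

/-- The alignment coefficient `ψ⁺` of the members `j, j'` of the second group. -/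
def alignY {N₁ N₂ : ℕ} (ω : Network N₁ N₂) (j j' : Fin N₂) : ℝ :=
  coeff ω (Sum.inr (Sum.inl s(j, j')))

/-- The anti-alignment coefficient `ψ⁻` of `i` in the first and `j` in the second group. -/
def anti {N₁ N₂ : ℕ} (ω : Network N₁ N₂) (i : Fin N₁) (j : Fin N₂) : ℝ :=
  coeff ω (Sum.inr (Sum.inr (i, j)))

/-- The success probability of the coefficient of a pair: `p` within a group, `q` across. -/
def rate (p q : unitInterval) {N₁ N₂ : ℕ} : Link N₁ N₂ → unitInterval
  | Sum.inl _ => p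
  | Sum.inr (Sum.inl _) => p
  | Sum.inr (Sum.inr _) => q

/-- The law of the network: the coefficients of all pairs are mutually independent, `B(p)` within
a group and `B(q)` between the groups. -/
def networkLaw (p q : unitInterval) (N₁ N₂ : ℕ) : Measure (Network N₁ N₂) :=
  Measure.pi fun e => ProbabilityTheory.bernoulliMeasure true false (rate p q e)

/-- `(x, y)` solves, for all times `t ≥ 0`, the alignment/anti-alignment system with the
time-independent coefficients given by `ω`. -/
def IsSolution {d N₁ N₂ : ℕ} (ω : Network N₁ N₂)
    (x : ℝ → Config d N₁) (y : ℝ → Config d N₂) : Prop :=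
  (∀ t : ℝ, 0 ≤ t → ∀ i, HasDerivWithinAt (fun s => x s i)
    ((1 / (N₁ : ℝ)) • (∑ i' with i' ≠ i, alignX ω i i' • (x t i' - x t i))
      - (1 / (N₂ : ℝ)) • ∑ j, anti ω i j • (y t j - x t i)) (Set.Ici 0) t) ∧
  (∀ t : ℝ, 0 ≤ t → ∀ j, HasDerivWithinAt (fun s => y s j)
    ((1 / (N₂ : ℝ)) • (∑ j' with j' ≠ j, alignY ω j j' • (y t j' - y t j))
      - (1 / (N₁ : ℝ)) • ∑ i, anti ω i j • (x t i - y t j)) (Set.Ici 0) t)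

/-- `L²` and `L^∞` separation for the network `ω`, with thresholds `lm` (`λ₋`) and `lp` (`λ₊`),
rate `μ` and constant `K`: every solution, in any dimension, whose initial group means differ and
whose initial ratio is at most `λ₊` satisfies both bounds for all times `t ≥ 0` (and its group
means stay different, so that the ratios are meaningful). -/
def Separates {N₁ N₂ : ℕ} (ω : Network N₁ N₂) (lm lp μ K : ℝ) : Prop :=
  ∀ (d : ℕ) (x : ℝ → Config d N₁) (y : ℝ → Config d N₂), IsSolution ω x y →
    mean (x 0) ≠ mean (y 0) → ratio (x 0) (y 0) ≤ lp →
    ∀ t : ℝ, 0 ≤ t →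
      mean (x t) ≠ mean (y t) ∧
      ratio (x t) (y t) ≤ lm + (ratio (x 0) (y 0) - lm) * Real.exp (-(μ * t)) ∧
      maxRatio (x t) (y t) ≤ K * (lm + maxRatio (x 0) (y 0) * Real.exp (-(μ * t)))

/-- The pairs of group sizes `(N₁, N₂)` that are comparable up to the factor `κ`. -/
def Comparable (κ : ℝ) : Set (ℕ × ℕ) :=
  {n | 1 / κ * (n.1 : ℝ) ≤ n.2 ∧ (n.2 : ℝ) ≤ κ * n.1}

end Opinion

end

/-! Split every coefficient into its mean and a centred noise. Without noise the gap D between the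
group means solves D' = 2qD and every deviation has growth rate q - p. So the ratio of V = var x +
var y to E = |D|² decays at rate 2p + 2q: repulsion stretches the gap faster than the groups. The
claimed rate p/2 leaves room for the noise.

The noise enters in two strengths. Its normalized row and column sums are at most δ ~ log N / √N, by
Hoeffding and a union bound. As bilinear forms, the noise matrices need only stay below a fixed
small ε, which follows from Markov's inequality for the Gram matrix (`gramSq_gt_le`, `bilinear_le`).
Since deviations sum to zero and alignment is symmetric, D meets only row and column sums, and
(`energy_deriv_le`, `gap_deriv_ge`) V' ≤ 2(q - p + 2ε + 2δ)V + 4δ√(EV), E' ≥ 4(q - δ)E - 8δ√(EV). At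
V = k²E the forcing 4δk is harmless if δ² is small against λ₋, and the feedback 8δk³ if δ²λ₊ is
small. A barrier argument (`Thresholds.energy_le`) then gives the L² bound, with λ₋ = log²N / N and
λ₊ = 1/λ₋, both tied to δ² by constants.

For L^∞, a single deviation is damped in the same way and forced by √V, which is already controlled.
A second barrier (`Thresholds.deviation_le`) closes the estimate. -/

namespace Opinion

/-! ### Hoeffding bounds for row sums of the noise. -/

open ProbabilityTheory

/-- The centred coefficient of a pair. -/
noncomputable def noise (p q : unitInterval) {N₁ N₂ : ℕ} (e : Link N₁ N₂) (ω : Network N₁ N₂) : ℝ :=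
  coeff ω e - rate p q e

instance (p q : unitInterval) (N₁ N₂ : ℕ) : IsProbabilityMeasure (networkLaw p q N₁ N₂) := by
  unfold networkLaw; infer_instance

variable {p q : unitInterval} {N₁ N₂ : ℕ}

lemma integrable_network (f : Network N₁ N₂ → ℝ) : Integrable f (networkLaw p q N₁ N₂) :=
  Integrable.of_finite

lemma abs_noise_le_one (e : Link N₁ N₂) (ω : Network N₁ N₂) : |noise p q e ω| ≤ 1 := by
  have h0 := (rate p q e).2.1
  have h1 := (rate p q e).2.2
  unfold noise coeff
  rw [abs_le]
  split_ifs <;> constructor <;> linarith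

lemma integral_noise (e : Link N₁ N₂) : ∫ ω, noise p q e ω ∂(networkLaw p q N₁ N₂) = 0 := by
  have h := integral_comp_eval (μ := fun e : Link N₁ N₂ => bernoulliMeasure true false (rate p q e))
    (i := e) (f := fun b : Bool => (if b then (1 : ℝ) else 0) - rate p q e)
    (Measurable.of_discrete.aestronglyMeasurable)
  unfold networkLaw
  refine h.trans ?_
  rw [integral_bernoulliMeasure]
  simp
  ring

lemma iIndepFun_noise :
    iIndepFun (fun e : Link N₁ N₂ => noise p q e) (networkLaw p q N₁ N₂) :=
  iIndepFun_pi (μ := fun e : Link N₁ N₂ => bernoulliMeasure true false (rate p q e))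
    (X := fun e (b : Bool) => (if b then (1 : ℝ) else 0) - rate p q e)
    (fun _ => Measurable.of_discrete.aemeasurable)

/-- Hoeffding's lemma: the noise lives in an interval of length 1, so the variance proxy is 1/4
whatever the rate of the pair. -/
lemma hasSubgaussianMGF_noise (e : Link N₁ N₂) :
    HasSubgaussianMGF (noise p q e) ((‖(1 : ℝ) - 0‖₊ / 2) ^ 2) (networkLaw p q N₁ N₂) := by
  have h := hasSubgaussianMGF_of_mem_Icc_of_integral_eq_zero
    (μ := networkLaw p q N₁ N₂) (X := noise p q e) (a := -(rate p q e : ℝ)) (b := 1 - rate p q e)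
    Measurable.of_discrete.aemeasurable
    (ae_of_all _ fun ω => by
      unfold noise coeff
      split_ifs <;> constructor <;> linarith) (integral_noise e)
  convert h using 3
  congr 1
  ring

lemma noise_sum_ge_le (s : Finset (Link N₁ N₂)) {t : ℝ} (ht : 0 ≤ t) :
    (networkLaw p q N₁ N₂).real {ω | t * s.card ≤ ∑ e ∈ s, noise p q e ω}
      ≤ Real.exp (-(2 * t ^ 2 * s.card)) := by
  have h := HasSubgaussianMGF.measure_sum_ge_le_of_iIndepFun
    (iIndepFun_noise (p := p) (q := q) (N₁ := N₁) (N₂ := N₂)) (s := s)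
    (fun e _ => hasSubgaussianMGF_noise e) (ε := t * s.card) (by positivity)
  refine h.trans (Real.exp_le_exp.2 ?_)
  rcases Nat.eq_zero_or_pos s.card with h0 | h0
  · simp [h0]
  · have : (0 : ℝ) < s.card := by exact_mod_cast h0
    simp
    field_simp
    norm_num

lemma neg_noise_sum_ge_le (s : Finset (Link N₁ N₂)) {t : ℝ} (ht : 0 ≤ t) :
    (networkLaw p q N₁ N₂).real {ω | t * s.card ≤ -∑ e ∈ s, noise p q e ω}
      ≤ Real.exp (-(2 * t ^ 2 * s.card)) := by
  have h := HasSubgaussianMGF.measure_sum_ge_le_of_iIndepFun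
    (X := fun e : Link N₁ N₂ => -noise p q e)
    ((iIndepFun_noise (p := p) (q := q) (N₁ := N₁) (N₂ := N₂)).comp (fun _ => Neg.neg)
      (fun _ => measurable_neg)) (s := s)
    (fun e _ => (hasSubgaussianMGF_noise e).neg) (ε := t * s.card) (by positivity)
  simp only [Pi.neg_apply, Finset.sum_neg_distrib] at h
  refine h.trans (Real.exp_le_exp.2 ?_)
  rcases Nat.eq_zero_or_pos s.card with h0 | h0
  · simp [h0]
  · have : (0 : ℝ) < s.card := by exact_mod_cast h0
    simp
    field_simp
    norm_num

/-- **Hoeffding's inequality** for the centred coefficients of a set of pairs. -/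
lemma abs_noise_sum_ge_le (s : Finset (Link N₁ N₂)) {t : ℝ} (ht : 0 ≤ t) :
    (networkLaw p q N₁ N₂).real {ω | t * s.card ≤ |∑ e ∈ s, noise p q e ω|}
      ≤ 2 * Real.exp (-(2 * t ^ 2 * s.card)) := by
  have : {ω | t * s.card ≤ |∑ e ∈ s, noise p q e ω|} =
      {ω | t * s.card ≤ ∑ e ∈ s, noise p q e ω} ∪ {ω | t * s.card ≤ -∑ e ∈ s, noise p q e ω} := by
    ext ω; simp [le_abs]
  rw [this, two_mul]
  exact (measureReal_union_le _ _).trans (add_le_add (noise_sum_ge_le s ht) (neg_noise_sum_ge_le s ht))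

/-- If every row of an array of pairs has distinct entries, then all rows of the array of
centred coefficients have small sums with high probability. -/
lemma row_sum_ge_le {m n : ℕ} (E : Fin m → Fin n → Link N₁ N₂)
    (hE : ∀ i, Function.Injective (E i)) {t : ℝ} (ht : 0 ≤ t) :
    (networkLaw p q N₁ N₂).real {ω | ∃ i, t * n ≤ |∑ j, noise p q (E i j) ω|}
      ≤ m * (2 * Real.exp (-(2 * t ^ 2 * n))) := by
  classical
  have : {ω : Network N₁ N₂ | ∃ i, t * n ≤ |∑ j, noise p q (E i j) ω|} =
      ⋃ i, {ω | t * n ≤ |∑ j, noise p q (E i j) ω|} := by ext; simp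
  rw [this]
  refine (measureReal_iUnion_fintype_le _).trans ?_
  have key : ∀ i, (networkLaw p q N₁ N₂).real {ω | t * n ≤ |∑ j, noise p q (E i j) ω|}
      ≤ 2 * Real.exp (-(2 * t ^ 2 * n)) := by
    intro i
    have h := abs_noise_sum_ge_le (p := p) (q := q) (Finset.univ.image (E i)) ht
    simpa [Finset.card_image_of_injective _ (hE i), Finset.sum_image (hE i).injOn] using h
  simpa using Finset.sum_le_sum fun i (_ : i ∈ Finset.univ) => key i

/-! ### Second moment of the Gram matrix of the noise. -/

lemma integral_noise_mul_eq_zero {e₁ e₂ e₃ e₄ : Link N₁ N₂} (h : e₁ ∉ [e₂, e₃, e₄]) :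
    ∫ ω, noise p q e₁ ω * (noise p q e₂ ω * noise p q e₃ ω * noise p q e₄ ω)
      ∂(networkLaw p q N₁ N₂) = 0 := by
  classical
  have hd : Disjoint ({e₁} : Finset (Link N₁ N₂)) {e₂, e₃, e₄} := by
    simpa using h
  have hi := (iIndepFun_noise (p := p) (q := q) (N₁ := N₁) (N₂ := N₂)).indepFun_finset _ _ hd
    (fun _ => Measurable.of_discrete)
  have h₁ : Measurable fun f : ({e₁} : Finset (Link N₁ N₂)) → ℝ => f ⟨e₁, by simp⟩ := by fun_prop
  have h₂ : Measurable fun f : ({e₂, e₃, e₄} : Finset (Link N₁ N₂)) → ℝ =>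
      f ⟨e₂, by simp⟩ * f ⟨e₃, by simp⟩ * f ⟨e₄, by simp⟩ := by fun_prop
  have hi' := hi.comp h₁ h₂
  have := hi'.integral_mul_eq_mul_integral
    Measurable.of_discrete.aestronglyMeasurable Measurable.of_discrete.aestronglyMeasurable
  refine this.trans ?_
  have h0 := integral_noise (p := p) (q := q) e₁
  simp only [Function.comp_def]
  rw [h0, zero_mul]

/-- Two different rows `i, k` and two different columns `j, l` of the array of pairs have a
pair among the four entries that occurs only once. -/
def Spread {m n : ℕ} (E : Fin m → Fin n → Link N₁ N₂) : Prop :=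
  ∀ i k j l, i ≠ k → j ≠ l →
    E i j ∉ [E i l, E k j, E k l] ∨ E i l ∉ [E i j, E k j, E k l]

/-- If both rows and columns differ, an entry occurring only once is independent of the other three
and has mean zero, so the term vanishes. The remaining terms are at most 1. -/
lemma integral_gram_term_le {m n : ℕ} {E : Fin m → Fin n → Link N₁ N₂} (hE : Spread E)
    (i k : Fin m) (j l : Fin n) :
    ∫ ω, (noise p q (E i j) ω * noise p q (E i l) ω) * (noise p q (E k j) ω * noise p q (E k l) ω)
      ∂(networkLaw p q N₁ N₂) ≤ (if i = k then 1 else 0) + (if j = l then 1 else 0) := by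
  by_cases h : i ≠ k ∧ j ≠ l
  · refine le_of_eq_of_le ?_ (by positivity)
    rcases hE i k j l h.1 h.2 with h' | h'
    · rw [← integral_noise_mul_eq_zero (p := p) (q := q) h']
      congr 1; ext ω; ring
    · rw [← integral_noise_mul_eq_zero (p := p) (q := q) h']
      congr 1; ext ω; ring
  · have h1 : (1 : ℝ) ≤ (if i = k then 1 else 0) + (if j = l then 1 else 0) := by
      by_cases hi : i = k
      · simp only [hi, if_true]; split_ifs <;> norm_num
      · have : j = l := by tauto
        simp [hi, this]
    refine le_trans ?_ h1
    calc _ ≤ ∫ _ω, (1 : ℝ) ∂(networkLaw p q N₁ N₂) := by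
          refine integral_mono (integrable_network _) (integrable_network _) fun ω => ?_
          refine (le_abs_self _).trans ?_
          simp only [abs_mul]
          exact mul_le_one₀ (mul_le_one₀ (abs_noise_le_one _ _) (abs_nonneg _) (abs_noise_le_one _ _))
            (by positivity) (mul_le_one₀ (abs_noise_le_one _ _) (abs_nonneg _) (abs_noise_le_one _ _))
      _ = 1 := by simp

/-- The squared Frobenius norm of the Gram matrix of the columns of `a`. -/
noncomputable def gramSq {m n : ℕ} (a : Fin m → Fin n → ℝ) : ℝ :=
  ∑ j, ∑ l, (∑ i, a i j * a i l) ^ 2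

lemma gramSq_nonneg {m n : ℕ} (a : Fin m → Fin n → ℝ) : 0 ≤ gramSq a :=
  Finset.sum_nonneg fun _ _ => Finset.sum_nonneg fun _ _ => sq_nonneg _

/-- Only the mn² terms with i = k and the m²n terms with j = l contribute, out of m²n² in total. -/
lemma integral_gramSq_le {m n : ℕ} {E : Fin m → Fin n → Link N₁ N₂} (hE : Spread E) :
    ∫ ω, gramSq (fun i j => noise p q (E i j) ω) ∂(networkLaw p q N₁ N₂)
      ≤ (m : ℝ) * n * (m + n) := by
  unfold gramSq
  simp_rw [sq, Finset.sum_mul_sum]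
  rw [integral_finsetSum _ (fun _ _ => integrable_network _)]
  simp_rw [integral_finsetSum _ (fun _ _ => integrable_network _)]
  calc _ ≤ ∑ j : Fin n, ∑ l : Fin n, ∑ i : Fin m, ∑ k : Fin m,
        (((if i = k then 1 else 0) + (if j = l then 1 else 0) : ℝ)) := by
        gcongr
        exact integral_gram_term_le hE _ _ _ _
    _ = _ := by
      simp [Finset.sum_add_distrib]
      ring

/-- Markov's inequality. It is enough because ε stays fixed as the groups grow. -/
lemma gramSq_gt_le {m n : ℕ} (hm : 0 < m) (hn : 0 < n) {E : Fin m → Fin n → Link N₁ N₂}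
    (hE : Spread E) {ε : ℝ} (hε : 0 < ε) :
    (networkLaw p q N₁ N₂).real
        {ω | ε ^ 4 * (m * n) ^ 2 ≤ gramSq (fun i j => noise p q (E i j) ω)}
      ≤ (1 / m + 1 / n) / ε ^ 4 := by
  have hm' : (0 : ℝ) < m := by exact_mod_cast hm
  have hn' : (0 : ℝ) < n := by exact_mod_cast hn
  have h := mul_meas_ge_le_integral_of_nonneg (μ := networkLaw p q N₁ N₂)
    (f := fun ω => gramSq (fun i j => noise p q (E i j) ω))
    (ae_of_all _ fun ω => gramSq_nonneg _) (integrable_network _) (ε ^ 4 * (m * n) ^ 2)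
  have h2 := h.trans (integral_gramSq_le hE)
  rw [← le_div_iff₀' (by positivity)] at h2
  refine h2.trans (le_of_eq ?_)
  field_simp
  ring

end Opinion

namespace Opinion

/-! ### From Gram matrices to bilinear forms of the noise. -/

open scoped RealInnerProductSpace

/-- The fourth power of a bilinear form is controlled by the Gram matrix of its coefficients. -/
lemma bilinear_pow_four_le {d m n : ℕ} (a : Fin m → Fin n → ℝ) (u : Config d m) (w : Config d n) :
    (∑ i, ∑ j, a i j * ⟪u i, w j⟫) ^ 4
      ≤ gramSq a * ((∑ i, ‖u i‖ ^ 2) * ∑ j, ‖w j‖ ^ 2) ^ 2 := by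
  set T : ℝ := ∑ i, ‖∑ j, a i j • w j‖ ^ 2 with hT
  have hS : (∑ i, ∑ j, a i j * ⟪u i, w j⟫) ^ 2 ≤ (∑ i, ‖u i‖ ^ 2) * T := by
    have h1 : |∑ i, ∑ j, a i j * ⟪u i, w j⟫| ≤ ∑ i, ‖u i‖ * ‖∑ j, a i j • w j‖ := by
      refine (Finset.abs_sum_le_sum_abs _ _).trans (Finset.sum_le_sum fun i _ => ?_)
      have : ∑ j, a i j * ⟪u i, w j⟫ = ⟪u i, ∑ j, a i j • w j⟫ := by
        simp [inner_sum, inner_smul_right]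
      rw [this]
      exact abs_real_inner_le_norm _ _
    calc _ = |∑ i, ∑ j, a i j * ⟪u i, w j⟫| ^ 2 := (sq_abs _).symm
      _ ≤ (∑ i, ‖u i‖ * ‖∑ j, a i j • w j‖) ^ 2 := by gcongr
      _ ≤ _ := Finset.sum_mul_sq_le_sq_mul_sq _ _ _
  -- T is a quadratic form in `w` whose matrix is the Gram matrix, so a second Cauchy–Schwarz, over
  -- pairs of columns, produces `gramSq`.
  have hTeq : T = ∑ x : Fin n × Fin n, (∑ i, a i x.1 * a i x.2) * ⟪w x.1, w x.2⟫ := by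
    rw [hT, Fintype.sum_prod_type]
    simp_rw [← real_inner_self_eq_norm_sq, sum_inner, inner_sum, inner_smul_left, inner_smul_right,
      Finset.sum_mul]
    rw [Finset.sum_comm]
    refine Finset.sum_congr rfl fun j _ => ?_
    rw [Finset.sum_comm]
    refine Finset.sum_congr rfl fun l _ => Finset.sum_congr rfl fun i _ => ?_
    simp; ring
  have hT2 : T ^ 2 ≤ gramSq a * (∑ j, ‖w j‖ ^ 2) ^ 2 := by
    rw [hTeq]
    refine (Finset.sum_mul_sq_le_sq_mul_sq _ _ _).trans ?_
    rw [Fintype.sum_prod_type, Fintype.sum_prod_type]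
    refine mul_le_mul_of_nonneg_left ?_ (gramSq_nonneg a)
    rw [sq, Finset.sum_mul_sum]
    gcongr with j _ l _
    rw [← mul_pow]
    refine sq_le_sq' ?_ (real_inner_le_norm _ _)
    exact neg_le_of_abs_le (abs_real_inner_le_norm _ _)
  have h0 : 0 ≤ ∑ i, ‖u i‖ ^ 2 := by positivity
  calc (∑ i, ∑ j, a i j * ⟪u i, w j⟫) ^ 4 = ((∑ i, ∑ j, a i j * ⟪u i, w j⟫) ^ 2) ^ 2 := by ring
    _ ≤ ((∑ i, ‖u i‖ ^ 2) * T) ^ 2 := by gcongr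
    _ = (∑ i, ‖u i‖ ^ 2) ^ 2 * T ^ 2 := by ring
    _ ≤ (∑ i, ‖u i‖ ^ 2) ^ 2 * (gramSq a * (∑ j, ‖w j‖ ^ 2) ^ 2) := by gcongr
    _ = _ := by ring

/-- The root mean square of a configuration. -/
noncomputable def rms {d n : ℕ} (u : Config d n) : ℝ :=
  √((1 / (n : ℝ)) * ∑ i, ‖u i‖ ^ 2)

lemma rms_nonneg {d n : ℕ} (u : Config d n) : 0 ≤ rms u := Real.sqrt_nonneg _

lemma rms_sq {d n : ℕ} (u : Config d n) : rms u ^ 2 = (1 / (n : ℝ)) * ∑ i, ‖u i‖ ^ 2 :=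
  Real.sq_sqrt (by positivity)

lemma sum_norm_sq {d n : ℕ} (hn : 0 < n) (u : Config d n) : ∑ i, ‖u i‖ ^ 2 = n * rms u ^ 2 := by
  have : (n : ℝ) ≠ 0 := by positivity
  rw [rms_sq]; field_simp

lemma rms_dev_sq {d n : ℕ} (x : Config d n) : rms (dev x) ^ 2 = variance x := rms_sq _

lemma sum_norm_le {d n : ℕ} (hn : 0 < n) (u : Config d n) : ∑ i, ‖u i‖ ≤ n * rms u := by
  refine abs_le_of_sq_le_sq' ?_ (mul_nonneg (by positivity) (rms_nonneg u)) |>.2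
  have h := sq_sum_le_card_mul_sum_sq (s := Finset.univ) (f := fun i => ‖u i‖)
  rw [sum_norm_sq hn] at h
  simp only [Finset.card_univ, Fintype.card_fin] at h
  linarith

lemma bilinear_le {d m n : ℕ} (hm : 0 < m) (hn : 0 < n) {a : Fin m → Fin n → ℝ} {ε : ℝ}
    (hε : 0 ≤ ε) (ha : gramSq a ≤ ε ^ 4 * (m * n) ^ 2) (u : Config d m) (w : Config d n) :
    |∑ i, ∑ j, a i j * ⟪u i, w j⟫| ≤ ε * (m * n) * (rms u * rms w) := by
  have h := bilinear_pow_four_le a u w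
  rw [sum_norm_sq hm, sum_norm_sq hn] at h
  have h0 : 0 ≤ ε * (m * n) * (rms u * rms w) :=
    mul_nonneg (by positivity) (mul_nonneg (rms_nonneg _) (rms_nonneg _))
  refine le_of_pow_le_pow_left₀ (n := 4) (by norm_num) h0 ?_
  rw [Even.pow_abs (by decide)]
  refine h.trans ((mul_le_mul_of_nonneg_right ha (sq_nonneg _)).trans (le_of_eq ?_))
  ring

lemma sum_dev {d n : ℕ} (hn : 0 < n) (x : Config d n) : ∑ i, dev x i = 0 := by
  have : (n : ℝ) ≠ 0 := by positivity
  simp only [dev, mean, Finset.sum_sub_distrib, Finset.sum_const, Finset.card_univ, Fintype.card_fin]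
  rw [← Nat.cast_smul_eq_nsmul ℝ, smul_smul]
  field_simp
  simp

/-- The fluctuations `α` of the alignment coefficients in a group of `m` people, and `γ` of the
anti-alignment coefficients with a group of `n` people, are small: in each row and column the sum
is a `δ`-fraction of the number of entries, and the bilinear forms have norms of order `ε`. -/
structure SmallNoise {m n : ℕ} (ε δ : ℝ) (α : Fin m → Fin m → ℝ) (γ : Fin m → Fin n → ℝ) :
    Prop where
  symm : ∀ i i', α i i' = α i' i
  abs_align_le : ∀ i i', |α i i'| ≤ 1
  abs_anti_le : ∀ i j, |γ i j| ≤ 1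
  row_align : ∀ i, |∑ i', α i i'| ≤ δ * m
  row_anti : ∀ i, |∑ j, γ i j| ≤ δ * n
  col_anti : ∀ j, |∑ i, γ i j| ≤ δ * m
  form_align : ∀ {d : ℕ} (u w : Config d m),
    |∑ i, ∑ i', α i i' * ⟪u i, w i'⟫| ≤ ε * (m * m) * (rms u * rms w)
  form_anti : ∀ {d : ℕ} (u : Config d m) (w : Config d n),
    |∑ i, ∑ j, γ i j * ⟪u i, w j⟫| ≤ ε * (m * n) * (rms u * rms w)

/-- The velocity of a member of the group `x` against the group `y`. -/
noncomputable def drift {d m n : ℕ} (p q : ℝ) (α : Fin m → Fin m → ℝ) (γ : Fin m → Fin n → ℝ)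
    (x : Config d m) (y : Config d n) (i : Fin m) : EuclideanSpace ℝ (Fin d) :=
  (1 / (m : ℝ)) • (∑ i', (p + α i i') • (x i' - x i))
    - (1 / (n : ℝ)) • ∑ j, (q + γ i j) • (y j - x i)

/-! ### Velocity estimates at a fixed time. -/

section Static

variable {d m n : ℕ} {p q ε δ : ℝ} {α : Fin m → Fin m → ℝ} {γ : Fin m → Fin n → ℝ}

/-- Deviations sum to zero, so the constant coefficients leave only -p times the deviation and q
times the displacement from the opposite mean; all else is noise. -/
lemma drift_eq (hm : 0 < m) (hn : 0 < n) (x : Config d m) (y : Config d n) (i : Fin m) :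
    drift p q α γ x y i =
      (1 / (m : ℝ)) • (∑ i', α i i' • dev x i') - ((1 / (m : ℝ)) * ∑ i', α i i') • dev x i
        - p • dev x i + ((1 / (n : ℝ)) * ∑ j, γ i j) • (mean x - mean y + dev x i)
        + q • (mean x - mean y + dev x i) - (1 / (n : ℝ)) • ∑ j, γ i j • dev y j := by
  have hm' : (m : ℝ) ≠ 0 := by positivity
  have hn' : (n : ℝ) ≠ 0 := by positivity
  have h1 : ∑ i', (p + α i i') • (x i' - x i) =
      ∑ i', α i i' • dev x i' - (∑ i', α i i') • dev x i - ((m : ℝ) * p) • dev x i := by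
    have : ∀ i', (p + α i i') • (x i' - x i) =
        α i i' • dev x i' - α i i' • dev x i + (p • dev x i' - p • dev x i) := by
      intro i'; simp only [dev]; module
    simp_rw [this, Finset.sum_add_distrib, Finset.sum_sub_distrib, ← Finset.smul_sum,
      ← Finset.sum_smul, sum_dev hm]
    simp only [Finset.sum_const, Finset.card_univ, Fintype.card_fin]
    rw [← Nat.cast_smul_eq_nsmul ℝ]
    module
  have h2 : ∑ j, (q + γ i j) • (y j - x i) =
      ∑ j, γ i j • dev y j - (∑ j, γ i j) • (mean x - mean y + dev x i)
        - ((n : ℝ) * q) • (mean x - mean y + dev x i) := by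
    have : ∀ j, (q + γ i j) • (y j - x i) =
        γ i j • dev y j - γ i j • (mean x - mean y + dev x i)
          + (q • dev y j - q • (mean x - mean y + dev x i)) := by
      intro j; simp only [dev]; module
    simp_rw [this, Finset.sum_add_distrib, Finset.sum_sub_distrib, ← Finset.smul_sum,
      ← Finset.sum_smul, sum_dev hn]
    simp only [Finset.sum_const, Finset.card_univ, Fintype.card_fin]
    rw [← Nat.cast_smul_eq_nsmul ℝ]
    module
  rw [drift, h1, h2]
  simp only [smul_sub, smul_smul, ← mul_assoc, one_div, inv_mul_cancel₀ hm', inv_mul_cancel₀ hn',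
    one_mul]
  module

lemma norm_sum_smul_le {k : ℕ} (hk : 0 < k) {β : Fin k → ℝ} {c : ℝ} (hc : 0 ≤ c)
    (hβ : ∀ i, |β i| ≤ c) (u : Config d k) : ‖∑ i, β i • u i‖ ≤ c * (k * rms u) := by
  calc _ ≤ ∑ i, ‖β i • u i‖ := norm_sum_le _ _
    _ ≤ ∑ i, c * ‖u i‖ := by
      refine Finset.sum_le_sum fun i _ => ?_
      rw [norm_smul, Real.norm_eq_abs]
      exact mul_le_mul_of_nonneg_right (hβ i) (norm_nonneg _)
    _ = c * ∑ i, ‖u i‖ := by rw [Finset.mul_sum]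
    _ ≤ _ := mul_le_mul_of_nonneg_left (sum_norm_le hk u) hc

/-- Alignment acts by pairwise opposite forces, so by symmetry it does not move the group mean. What
remains of the noise is row and column sums of γ. -/
lemma sum_drift_eq (hm : 0 < m) (hn : 0 < n) (hα : ∀ i i', α i i' = α i' i)
    (x : Config d m) (y : Config d n) :
    ∑ i, drift p q α γ x y i = ((m : ℝ) * q) • (mean x - mean y)
      + (1 / (n : ℝ)) • ((∑ i, ∑ j, γ i j) • (mean x - mean y)
        + ∑ i, (∑ j, γ i j) • dev x i - ∑ j, (∑ i, γ i j) • dev y j) := by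
  have h1 : ∑ i, (1 / (m : ℝ)) • (∑ i', α i i' • dev x i')
      = ∑ i, ((1 / (m : ℝ)) * ∑ i', α i i') • dev x i := by
    simp_rw [mul_smul, ← Finset.smul_sum, Finset.sum_smul]
    rw [Finset.sum_comm]
    simp_rw [fun i i' => hα i i']
  have h2 : ∑ i, (1 / (n : ℝ)) • ∑ j, γ i j • dev y j
      = (1 / (n : ℝ)) • ∑ j, (∑ i, γ i j) • dev y j := by
    simp_rw [← Finset.smul_sum, Finset.sum_smul]
    rw [Finset.sum_comm]
  simp_rw [drift_eq hm hn, Finset.sum_sub_distrib, Finset.sum_add_distrib, Finset.sum_sub_distrib]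
  rw [h1, h2]
  simp_rw [smul_add, Finset.sum_add_distrib, mul_smul, ← Finset.smul_sum, sum_dev hm,
    ← Finset.sum_smul]
  simp only [Finset.sum_const, Finset.card_univ, Fintype.card_fin]
  rw [← Nat.cast_smul_eq_nsmul ℝ]
  module

lemma norm_mean_drift_sub_le (hm : 0 < m) (hn : 0 < n) (hδ : 0 ≤ δ) (h : SmallNoise ε δ α γ)
    (x : Config d m) (y : Config d n) :
    ‖(1 / (m : ℝ)) • ∑ i, drift p q α γ x y i - q • (mean x - mean y)‖
      ≤ δ * (‖mean x - mean y‖ + rms (dev x) + rms (dev y)) := by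
  have hm' : (0 : ℝ) < m := by positivity
  have hn' : (0 : ℝ) < n := by positivity
  have e : (1 / (m : ℝ)) • ∑ i, drift p q α γ x y i - q • (mean x - mean y)
      = (1 / ((m : ℝ) * n)) • ((∑ i, ∑ j, γ i j) • (mean x - mean y)
        + ∑ i, (∑ j, γ i j) • dev x i - ∑ j, (∑ i, γ i j) • dev y j) := by
    rw [sum_drift_eq hm hn h.symm, smul_add, smul_smul, smul_smul, ← mul_assoc,
      one_div_mul_cancel hm'.ne', one_mul, add_sub_cancel_left, one_div_mul_one_div]
  rw [e, norm_smul, Real.norm_of_nonneg (by positivity), one_div, inv_mul_le_iff₀ (by positivity)]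
  have h1 : ‖(∑ i, ∑ j, γ i j) • (mean x - mean y)‖ ≤ m * (δ * n) * ‖mean x - mean y‖ := by
    rw [norm_smul, Real.norm_eq_abs]
    gcongr
    refine (Finset.abs_sum_le_sum_abs _ _).trans ?_
    simpa using Finset.sum_le_sum fun i (_ : i ∈ Finset.univ) => h.row_anti i
  have h2 := norm_sum_smul_le hm (by positivity) h.row_anti (dev x)
  have h3 := norm_sum_smul_le hn (by positivity) h.col_anti (dev y)
  refine (norm_sub_le _ _).trans ((add_le_add (norm_add_le _ _) le_rfl).trans ?_)
  nlinarith

/-- The gap couples to the variance only through row sums of γ, hence with the small factor δ;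
products of two deviations are handled by the bilinear bounds and cost ε. -/
lemma sum_inner_drift_le (hm : 0 < m) (hn : 0 < n) (hδ : 0 ≤ δ) (h : SmallNoise ε δ α γ)
    (x : Config d m) (y : Config d n) :
    (1 / (m : ℝ)) * ∑ i, ⟪dev x i, drift p q α γ x y i⟫
      ≤ (-p + q + ε + 2 * δ) * rms (dev x) ^ 2 + δ * ‖mean x - mean y‖ * rms (dev x)
        + ε * (rms (dev x) * rms (dev y)) := by
  have hm' : (0 : ℝ) < m := by positivity
  have hn' : (0 : ℝ) < n := by positivity
  have e : ∑ i, ⟪dev x i, drift p q α γ x y i⟫ =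
      (1 / (m : ℝ)) * ∑ i, ∑ i', α i i' * ⟪dev x i, dev x i'⟫
      + ∑ i, (-((1 / (m : ℝ)) * ∑ i', α i i') * ‖dev x i‖ ^ 2
          + ((1 / (n : ℝ)) * ∑ j, γ i j) * (⟪dev x i, mean x - mean y⟫ + ‖dev x i‖ ^ 2))
      + (-p + q) * ∑ i, ‖dev x i‖ ^ 2
      - (1 / (n : ℝ)) * ∑ i, ∑ j, γ i j * ⟪dev x i, dev y j⟫ := by
    -- The mean repulsion along the gap moves the group as a whole and does not change its variance.
    have hz : ∑ i, q * ⟪dev x i, mean x - mean y⟫ = 0 := by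
      rw [← Finset.mul_sum, ← sum_inner, sum_dev hm, inner_zero_left, mul_zero]
    rw [← sub_zero (∑ i, ⟪dev x i, drift p q α γ x y i⟫), ← hz]
    simp_rw [Finset.mul_sum, ← Finset.sum_add_distrib, ← Finset.sum_sub_distrib]
    refine Finset.sum_congr rfl fun i _ => ?_
    rw [drift_eq hm hn]
    simp only [inner_sub_right, inner_add_right, inner_smul_right, inner_sum,
      real_inner_self_eq_norm_sq, Finset.mul_sum]
    ring
  have h1 := (abs_le.1 (h.form_align (dev x) (dev x))).2
  have h2 := (abs_le.1 (h.form_anti (dev x) (dev y))).1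
  have h3 : ∑ i, (-((1 / (m : ℝ)) * ∑ i', α i i') * ‖dev x i‖ ^ 2
          + ((1 / (n : ℝ)) * ∑ j, γ i j) * (⟪dev x i, mean x - mean y⟫ + ‖dev x i‖ ^ 2))
      ≤ 2 * δ * ∑ i, ‖dev x i‖ ^ 2 + δ * ‖mean x - mean y‖ * ∑ i, ‖dev x i‖ := by
    rw [Finset.mul_sum, Finset.mul_sum, ← Finset.sum_add_distrib]
    refine Finset.sum_le_sum fun i _ => ?_
    have a1 : -((1 / (m : ℝ)) * ∑ i', α i i') ≤ δ := by
      have := (abs_le.1 (h.row_align i)).1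
      rw [one_div, ← mul_neg, inv_mul_le_iff₀ hm']
      linarith
    have a2 : |(1 / (n : ℝ)) * ∑ j, γ i j| ≤ δ := by
      rw [abs_mul, abs_of_pos (by positivity), one_div, inv_mul_le_iff₀ hn']
      linarith [h.row_anti i]
    have a3 : ((1 / (n : ℝ)) * ∑ j, γ i j) * ⟪dev x i, mean x - mean y⟫
        ≤ δ * (‖dev x i‖ * ‖mean x - mean y‖) := by
      refine (le_abs_self _).trans ?_
      rw [abs_mul]
      exact mul_le_mul a2 (abs_real_inner_le_norm _ _) (abs_nonneg _) hδ
    have a4 := mul_le_mul_of_nonneg_right a1 (sq_nonneg ‖dev x i‖)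
    have a5 := mul_le_mul_of_nonneg_right (le_of_abs_le a2) (sq_nonneg ‖dev x i‖)
    linarith
  have h4 := mul_le_mul_of_nonneg_left (sum_norm_le hm (dev x))
    (mul_nonneg hδ (norm_nonneg (mean x - mean y)))
  rw [sum_norm_sq hm] at h3 e
  have h5 : (1 / (m : ℝ)) * ∑ i, ∑ i', α i i' * ⟪dev x i, dev x i'⟫
      ≤ ε * m * rms (dev x) ^ 2 := by
    rw [one_div, inv_mul_le_iff₀ hm']
    linarith
  have h6 : -(ε * m * (rms (dev x) * rms (dev y)))
      ≤ (1 / (n : ℝ)) * ∑ i, ∑ j, γ i j * ⟪dev x i, dev y j⟫ := by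
    rw [one_div, ← neg_le_neg_iff, ← mul_neg, inv_mul_le_iff₀ hn']
    linarith
  rw [one_div_mul_eq_div, div_le_iff₀' hm', e]
  linarith

/-- For one member the bilinear bounds give nothing, so the noise acting on the other deviations is
bounded entrywise by 1. The resulting rms terms carry no small factor, but the L² bound already
controls them. -/
lemma inner_drift_sub_le (hm : 0 < m) (hn : 0 < n) (hδ : 0 ≤ δ) (h : SmallNoise ε δ α γ)
    (x : Config d m) (y : Config d n) (i : Fin m) :
    ⟪dev x i, drift p q α γ x y i - (1 / (m : ℝ)) • ∑ k, drift p q α γ x y k⟫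
      ≤ (-p + q + 2 * δ) * ‖dev x i‖ ^ 2 + ‖dev x i‖ * (rms (dev x) + rms (dev y)
        + δ * (2 * ‖mean x - mean y‖ + rms (dev x) + rms (dev y))) := by
  have hm' : (0 : ℝ) < m := by positivity
  have hn' : (0 : ℝ) < n := by positivity
  set D := mean x - mean y with hD
  set R := (1 / (m : ℝ)) • ∑ k, drift p q α γ x y k - q • D with hR
  have hRle : ‖R‖ ≤ δ * (‖D‖ + rms (dev x) + rms (dev y)) :=
    norm_mean_drift_sub_le hm hn hδ h x y
  have e : drift p q α γ x y i - (1 / (m : ℝ)) • ∑ k, drift p q α γ x y k =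
      (-p + q - (1 / (m : ℝ)) * (∑ i', α i i') + (1 / (n : ℝ)) * ∑ j, γ i j) • dev x i
      + ((1 / (m : ℝ)) • (∑ i', α i i' • dev x i') + ((1 / (n : ℝ)) * ∑ j, γ i j) • D
        - (1 / (n : ℝ)) • (∑ j, γ i j • dev y j) - R) := by
    rw [hR, drift_eq hm hn, ← hD]; module
  have a1 : |(1 / (m : ℝ)) * ∑ i', α i i'| ≤ δ := by
    rw [abs_mul, abs_of_pos (by positivity), one_div, inv_mul_le_iff₀ hm']
    linarith [h.row_align i]
  have a2 : |(1 / (n : ℝ)) * ∑ j, γ i j| ≤ δ := by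
    rw [abs_mul, abs_of_pos (by positivity), one_div, inv_mul_le_iff₀ hn']
    linarith [h.row_anti i]
  have b1 : ‖(1 / (m : ℝ)) • (∑ i', α i i' • dev x i')‖ ≤ rms (dev x) := by
    rw [norm_smul, Real.norm_of_nonneg (by positivity), one_div, inv_mul_le_iff₀ hm']
    simpa using norm_sum_smul_le hm zero_le_one (h.abs_align_le i) (dev x)
  have b2 : ‖(1 / (n : ℝ)) • (∑ j, γ i j • dev y j)‖ ≤ rms (dev y) := by
    rw [norm_smul, Real.norm_of_nonneg (by positivity), one_div, inv_mul_le_iff₀ hn']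
    simpa using norm_sum_smul_le hn zero_le_one (h.abs_anti_le i) (dev y)
  have b3 : ‖((1 / (n : ℝ)) * ∑ j, γ i j) • D‖ ≤ δ * ‖D‖ := by
    rw [norm_smul, Real.norm_eq_abs]
    exact mul_le_mul_of_nonneg_right a2 (norm_nonneg _)
  rw [e, inner_add_right, inner_smul_right, real_inner_self_eq_norm_sq]
  refine add_le_add (mul_le_mul_of_nonneg_right ?_ (sq_nonneg _)) ?_
  · linarith [(abs_le.1 a1).1, (abs_le.1 a2).2]
  · refine (real_inner_le_norm _ _).trans (mul_le_mul_of_nonneg_left ?_ (norm_nonneg _))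
    refine (norm_sub_le _ _).trans ((add_le_add ((norm_sub_le _ _).trans
      (add_le_add (norm_add_le _ _) le_rfl)) le_rfl).trans ?_)
    linarith

end Static

end Opinion

namespace Opinion

open Set

/-! ### Barrier arguments for the scalar differential inequalities. -/

section Scalar

variable {p q ε δ lm lp l₀ : ℝ}

/-- A barrier argument: `f ≤ 0` persists if `f' < 0` wherever `f = 0`. -/
lemma nonpos_of_deriv_neg {f f' : ℝ → ℝ} {T : ℝ}
    (hf : ∀ t, 0 ≤ t → HasDerivWithinAt f (f' t) (Ici 0) t) (h0 : f 0 ≤ 0)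
    (hneg : ∀ t ∈ Ico 0 T, f t = 0 → f' t < 0) : ∀ t ∈ Icc 0 T, f t ≤ 0 := by
  have := image_le_of_deriv_right_lt_deriv_boundary (f := f) (f' := f') (a := 0) (b := T)
    (fun t ht => (hf t ht.1).continuousWithinAt.mono Icc_subset_Ici_self)
    (fun t ht => (hf t ht.1).mono (Ici_subset_Ici.2 ht.1)) (B := fun _ => 0) (B' := fun _ => 0)
    h0 (fun t => hasDerivAt_const t 0) hneg
  exact fun t ht => this ht

lemma le_of_deriv_nonneg {f f' : ℝ → ℝ} {T : ℝ}
    (hf : ∀ t, 0 ≤ t → HasDerivWithinAt f (f' t) (Ici 0) t)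
    (hnonneg : ∀ t ∈ Ico 0 T, 0 ≤ f' t) : ∀ t ∈ Icc 0 T, f 0 ≤ f t := by
  intro t ht
  have := image_le_of_deriv_right_le_deriv_boundary (f := fun _ => f 0) (f' := fun _ => 0) (a := 0)
    (b := T) continuousOn_const (fun t _ => hasDerivWithinAt_const _ _ _)
    (B := f) (B' := f') le_rfl
    (fun t ht => (hf t ht.1).continuousWithinAt.mono Icc_subset_Ici_self)
    (fun t ht => (hf t ht.1).mono (Ici_subset_Ici.2 ht.1)) hnonneg
  exact this ht

/-- The smallness of the noise that the separation of the groups requires. -/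
structure Thresholds (p q ε δ lm lp : ℝ) : Prop where
  p_pos : 0 < p
  p_le : p ≤ 1
  q_pos : 0 < q
  eps_le : ε ≤ p / 48
  delta_nonneg : 0 ≤ δ
  delta_le : δ ≤ p / 48
  delta_le' : δ ≤ q / 4
  delta_sq_lt : 32 * δ ^ 2 < p ^ 2 * lm
  lm_le : lm ≤ lp
  lp_le : 64 * δ ^ 2 * lp ≤ (p / 4) ^ 2
  lp_le' : 64 * δ ^ 2 * lp ≤ q ^ 2

/-- The bound for the `L²` ratio. -/
noncomputable def envelope (p lm l₀ t : ℝ) : ℝ := lm + (l₀ - lm) * Real.exp (-(p / 2 * t))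

lemma envelope_nonneg (hl : 0 ≤ l₀) (hp : 0 < p) (hlm : 0 ≤ lm) {t : ℝ} (ht : 0 ≤ t) :
    0 ≤ envelope p lm l₀ t := by
  have h1 : Real.exp (-(p / 2 * t)) ≤ 1 := Real.exp_le_one_iff.2 (by
    have : 0 ≤ p / 2 * t := by positivity
    linarith)
  have h2 := Real.exp_pos (-(p / 2 * t))
  unfold envelope
  nlinarith

lemma envelope_le (hl : l₀ ≤ lp) (hp : 0 < p) (hlm : lm ≤ lp) {t : ℝ} (ht : 0 ≤ t) :
    envelope p lm l₀ t ≤ lp := by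
  have h1 : Real.exp (-(p / 2 * t)) ≤ 1 := Real.exp_le_one_iff.2 (by
    have : 0 ≤ p / 2 * t := by positivity
    linarith)
  have h2 := Real.exp_pos (-(p / 2 * t))
  unfold envelope
  nlinarith

lemma hasDerivAt_exp_neg_mul (p t : ℝ) :
    HasDerivAt (fun s => Real.exp (-(p / 2 * s))) (-(p / 2) * Real.exp (-(p / 2 * t))) t := by
  have := ((hasDerivAt_id' t).const_mul (-(p / 2))).exp
  simpa [mul_comm, neg_mul] using this

lemma hasDerivAt_envelope (p lm l₀ t : ℝ) :
    HasDerivAt (envelope p lm l₀) (-(p / 2) * (envelope p lm l₀ t - lm)) t := by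
  have := ((hasDerivAt_exp_neg_mul p t).const_mul (l₀ - lm)).const_add lm
  refine this.congr_deriv ?_
  simp only [envelope]; ring

lemma Thresholds.lm_pos (h : Thresholds p q ε δ lm lp) : 0 < lm := by
  have h1 := h.delta_sq_lt
  have h2 := sq_nonneg δ
  have h3 := pow_pos h.p_pos 2
  by_contra hc
  nlinarith

lemma Thresholds.delta_mul_sqrt_le (h : Thresholds p q ε δ lm lp) {k : ℝ} (hk : k ^ 2 ≤ lp) :
    8 * δ * k ≤ p / 4 ∧ 8 * δ * k ≤ q := by
  have h1 := h.lp_le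
  have h2 := h.lp_le'
  have h3 : (8 * δ * k) ^ 2 ≤ 64 * δ ^ 2 * lp := by
    have := mul_le_mul_of_nonneg_left hk (sq_nonneg δ)
    nlinarith
  have := h.p_pos
  have := h.q_pos
  exact ⟨(abs_le_of_sq_le_sq' (h3.trans h1) (by positivity)).2,
    (abs_le_of_sq_le_sq' (h3.trans h2) (by positivity)).2⟩

/-- This bounds the derivative of V - (envelope)·E per unit of E at a contact point V = k²E. Young's
inequality splits the forcing 4δk into p/4 · k² and a term below p/2 · lm; the q terms have a
favourable sign. -/
lemma Thresholds.energy_barrier (h : Thresholds p q ε δ lm lp) {k : ℝ} (hk : k ^ 2 ≤ lp) :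
    2 * (-p + q + 2 * ε + 2 * δ) * k ^ 2 + 4 * δ * k + p / 2 * (k ^ 2 - lm)
      - k ^ 2 * (4 * q - 4 * δ - 8 * δ * k) < 0 := by
  obtain ⟨h1, -⟩ := h.delta_mul_sqrt_le hk
  have hp := h.p_pos
  have hq := h.q_pos
  have young : 4 * δ * k ≤ p / 4 * k ^ 2 + 16 * δ ^ 2 / p := by
    have : 0 ≤ (p * k - 8 * δ) ^ 2 / (4 * p) := by positivity
    have e : (p * k - 8 * δ) ^ 2 / (4 * p) = p / 4 * k ^ 2 + 16 * δ ^ 2 / p - 4 * δ * k := by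
      field_simp; ring
    linarith
  have h2 : 16 * δ ^ 2 / p < p / 2 * lm := by
    rw [div_lt_iff₀ hp]; linarith [h.delta_sq_lt]
  have h3 := mul_le_mul_of_nonneg_left h1 (sq_nonneg k)
  have h4 := mul_le_mul_of_nonneg_left h.eps_le (sq_nonneg k)
  have h5 := mul_le_mul_of_nonneg_left h.delta_le (sq_nonneg k)
  have h6 : 0 ≤ p * k ^ 2 := by positivity
  have h7 : 0 ≤ q * k ^ 2 := by positivity
  nlinarith

/-- The analogue for one member with squared deviation l²E, while V ≤ k²E. The forcing by V, of
order kl, becomes 64k²/p by Young's inequality. -/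
lemma Thresholds.deviation_barrier (h : Thresholds p q ε δ lm lp) {k l : ℝ} (hk0 : 0 ≤ k)
    (hl0 : 0 ≤ l) (hk : k ^ 2 ≤ lp) :
    2 * (-p + q + 2 * δ) * l ^ 2 + 2 * l * (2 * k + 2 * δ + 2 * δ * k)
      - l ^ 2 * (4 * q - 4 * δ - 8 * δ * k) < -p * l ^ 2 + 64 * k ^ 2 / p + p / 2 * lm := by
  obtain ⟨h1, -⟩ := h.delta_mul_sqrt_le hk
  have hp := h.p_pos
  have hq := h.q_pos
  have young : 4 * δ * l ≤ p / 4 * l ^ 2 + 16 * δ ^ 2 / p := by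
    have : 0 ≤ (p * l - 8 * δ) ^ 2 / (4 * p) := by positivity
    have e : (p * l - 8 * δ) ^ 2 / (4 * p) = p / 4 * l ^ 2 + 16 * δ ^ 2 / p - 4 * δ * l := by
      field_simp; ring
    linarith
  have young' : 8 * k * l ≤ p / 4 * l ^ 2 + 64 * k ^ 2 / p := by
    have : 0 ≤ (p * l - 16 * k) ^ 2 / (4 * p) := by positivity
    have e : (p * l - 16 * k) ^ 2 / (4 * p) = p / 4 * l ^ 2 + 64 * k ^ 2 / p - 8 * k * l := by
      field_simp; ring
    linarith
  have h2 : 16 * δ ^ 2 / p < p / 2 * lm := by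
    rw [div_lt_iff₀ hp]; linarith [h.delta_sq_lt]
  have h3 := mul_le_mul_of_nonneg_left h1 (sq_nonneg l)
  have h5 := mul_le_mul_of_nonneg_left h.delta_le (sq_nonneg l)
  have h6 : 0 ≤ p * l ^ 2 := by positivity
  have h7 : 0 ≤ q * l ^ 2 := by positivity
  have h8 : δ * (k * l) ≤ 1 * (k * l) :=
    mul_le_mul_of_nonneg_right (by linarith [h.delta_le, h.p_le]) (by positivity)
  nlinarith

variable {V V' E E' M M' : ℝ → ℝ}

/-- The barrier needs a strict sign at contact, which `Thresholds.energy_barrier` gives only after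
multiplying by E > 0; hence the a priori positivity up to T. -/
lemma Thresholds.energy_le_of_pos (h : Thresholds p q ε δ lm lp) (hl : l₀ ≤ lp) (hl₀ : 0 ≤ l₀)
    (hE0 : ∀ t, 0 ≤ E t)
    (hV : ∀ t, 0 ≤ t → HasDerivWithinAt V (V' t) (Ici 0) t)
    (hE : ∀ t, 0 ≤ t → HasDerivWithinAt E (E' t) (Ici 0) t)
    (hV' : ∀ t, 0 ≤ t →
      V' t ≤ 2 * (-p + q + 2 * ε + 2 * δ) * V t + 4 * δ * √(E t) * √(V t))
    (hE' : ∀ t, 0 ≤ t → 4 * q * E t - 4 * δ * E t - 8 * δ * √(E t) * √(V t) ≤ E' t)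
    (h0 : V 0 ≤ l₀ * E 0) {T : ℝ} (hpos : ∀ t ∈ Ico 0 T, 0 < E t) :
    ∀ t ∈ Icc 0 T, V t ≤ envelope p lm l₀ t * E t := by
  intro t ht
  have := nonpos_of_deriv_neg (T := T) (f := fun s => V s - envelope p lm l₀ s * E s)
    (f' := fun s => V' s - (-(p / 2) * (envelope p lm l₀ s - lm) * E s + envelope p lm l₀ s * E' s))
    (fun s hs => (hV s hs).sub ((hasDerivAt_envelope p lm l₀ s).hasDerivWithinAt.mul (hE s hs)))
    (by simpa [envelope] using h0) ?_ t ht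
  · simpa using this
  intro s hs hs0
  have e0 := envelope_nonneg hl₀ h.p_pos h.lm_pos.le hs.1
  have e1 := envelope_le hl h.p_pos h.lm_le hs.1
  have hVs : V s = envelope p lm l₀ s * E s := by simpa [sub_eq_zero] using hs0
  set k := √(envelope p lm l₀ s) with hkdef
  have hk : k ^ 2 = envelope p lm l₀ s := Real.sq_sqrt e0
  have hsqrt : √(V s) = k * √(E s) := by rw [hVs, Real.sqrt_mul e0]
  have hE2 : √(E s) * √(E s) = E s := Real.mul_self_sqrt (hE0 s)
  have b1 := hV' s hs.1
  have b2 := hE' s hs.1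
  have b3 := h.energy_barrier (k := k) (hk.trans_le e1)
  have b4 := mul_neg_of_neg_of_pos b3 (hpos s hs)
  rw [hsqrt] at b1 b2
  have c1 : 4 * δ * √(E s) * (k * √(E s)) = 4 * δ * k * E s := by
    linear_combination 4 * δ * k * hE2
  have c2 : 8 * δ * √(E s) * (k * √(E s)) = 8 * δ * k * E s := by
    linear_combination 8 * δ * k * hE2
  rw [c1, hVs, ← hk] at b1
  rw [c2] at b2
  have b5 := mul_le_mul_of_nonneg_left b2 (sq_nonneg k)
  simp only [← hk]
  linarith

/-- Below λ₊ the losses 4δ and 8δk are each at most q, less than the growth rate 4q. -/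
lemma Thresholds.gap_deriv_nonneg (h : Thresholds p q ε δ lm lp) (hl : l₀ ≤ lp) (hl₀ : 0 ≤ l₀)
    (hE0 : ∀ t, 0 ≤ E t)
    (hE' : ∀ t, 0 ≤ t → 4 * q * E t - 4 * δ * E t - 8 * δ * √(E t) * √(V t) ≤ E' t)
    {t : ℝ} (ht : 0 ≤ t) (hVt : V t ≤ envelope p lm l₀ t * E t) : 0 ≤ E' t := by
  have e0 := envelope_nonneg hl₀ h.p_pos h.lm_pos.le ht
  have e1 := envelope_le hl h.p_pos h.lm_le ht
  set k := √(envelope p lm l₀ t) with hkdef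
  have hk : k ^ 2 = envelope p lm l₀ t := Real.sq_sqrt e0
  have hsqrt : √(V t) ≤ k * √(E t) := by
    rw [hkdef, ← Real.sqrt_mul e0]; exact Real.sqrt_le_sqrt hVt
  have hE2 : √(E t) * √(E t) = E t := Real.mul_self_sqrt (hE0 t)
  have b := mul_le_mul_of_nonneg_left hsqrt
    (mul_nonneg (mul_nonneg (by norm_num : (0 : ℝ) ≤ 8) h.delta_nonneg) (Real.sqrt_nonneg (E t)))
  have c2 : 8 * δ * √(E t) * (k * √(E t)) = 8 * δ * k * E t := by
    linear_combination 8 * δ * k * hE2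
  rw [c2] at b
  have d1 := mul_le_mul_of_nonneg_right (h.delta_mul_sqrt_le (hk.trans_le e1)).2 (hE0 t)
  have d2 := mul_le_mul_of_nonneg_right h.delta_le' (hE0 t)
  have d3 := mul_nonneg h.q_pos.le (hE0 t)
  linarith [hE' t ht]

/-- The differential inequalities for the energy `V` and the squared gap `E` keep the gap open
and the ratio `V / E` below its envelope. -/
lemma Thresholds.energy_le (h : Thresholds p q ε δ lm lp) (hl : l₀ ≤ lp) (hl₀ : 0 ≤ l₀)
    (hE0 : ∀ t, 0 ≤ E t)
    (hV : ∀ t, 0 ≤ t → HasDerivWithinAt V (V' t) (Ici 0) t)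
    (hE : ∀ t, 0 ≤ t → HasDerivWithinAt E (E' t) (Ici 0) t)
    (hV' : ∀ t, 0 ≤ t →
      V' t ≤ 2 * (-p + q + 2 * ε + 2 * δ) * V t + 4 * δ * √(E t) * √(V t))
    (hE' : ∀ t, 0 ≤ t → 4 * q * E t - 4 * δ * E t - 8 * δ * √(E t) * √(V t) ≤ E' t)
    (h0 : V 0 ≤ l₀ * E 0) (hpos : 0 < E 0) :
    ∀ t, 0 ≤ t → 0 < E t ∧ V t ≤ envelope p lm l₀ t * E t := by
  have grow : ∀ T, (∀ t ∈ Ico 0 T, 0 < E t) → ∀ t ∈ Icc 0 T, E 0 ≤ E t := by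
    intro T hT
    refine le_of_deriv_nonneg hE fun t ht => h.gap_deriv_nonneg hl hl₀ hE0 hE' ht.1 ?_
    exact h.energy_le_of_pos hl hl₀ hE0 hV hE hV' hE' h0 hT t ⟨ht.1, ht.2.le⟩
  -- At the first zero s of E, positivity before s forces E s ≥ E 0 > 0, a contradiction.
  have allpos : ∀ t, 0 ≤ t → 0 < E t := by
    by_contra! hc
    obtain ⟨T, hT, hT0⟩ := hc
    have hcont : ContinuousOn E (Icc 0 T) := fun t ht =>
      (hE t ht.1).continuousWithinAt.mono Icc_subset_Ici_self
    have hclosed : IsClosed (Icc 0 T ∩ E ⁻¹' Iic 0) := hcont.preimage_isClosed_of_isClosed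
      isClosed_Icc isClosed_Iic
    obtain ⟨s, hs⟩ := (isCompact_Icc.of_isClosed_subset hclosed inter_subset_left).exists_isLeast
      ⟨T, ⟨hT, le_rfl⟩, hT0⟩
    have hs1 : E s ≤ 0 := hs.1.2
    have := grow s (fun t ht => by
      by_contra! hcon
      exact absurd (hs.2 ⟨⟨ht.1, ht.2.le.trans hs.1.1.2⟩, hcon⟩) (not_le.2 ht.2)) s
      ⟨hs.1.1.1, le_rfl⟩
    linarith
  intro t ht
  exact ⟨allpos t ht, h.energy_le_of_pos hl hl₀ hE0 hV hE hV' hE' h0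
    (fun s hs => allpos s hs.1) t ⟨ht, le_rfl⟩⟩

/-- The same for the squared deviation `M` of a single member. -/
lemma Thresholds.deviation_le (h : Thresholds p q ε δ lm lp) (hl : l₀ ≤ lp) (hl₀ : 0 ≤ l₀)
    {m₀ : ℝ} (hlm₀ : l₀ ≤ m₀) (hEpos : ∀ t, 0 ≤ t → 0 < E t)
    (hVE : ∀ t, 0 ≤ t → V t ≤ envelope p lm l₀ t * E t)
    (hE : ∀ t, 0 ≤ t → HasDerivWithinAt E (E' t) (Ici 0) t)
    (hE' : ∀ t, 0 ≤ t → 4 * q * E t - 4 * δ * E t - 8 * δ * √(E t) * √(V t) ≤ E' t)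
    (hM : ∀ t, 0 ≤ t → HasDerivWithinAt M (M' t) (Ici 0) t)
    (hM' : ∀ t, 0 ≤ t → M' t ≤ 2 * (-p + q + 2 * δ) * M t
      + 2 * √(M t) * (2 * √(V t) + 2 * δ * √(E t) + 2 * δ * √(V t)))
    (h0 : M 0 ≤ m₀ * E 0) :
    ∀ t, 0 ≤ t →
      M t ≤ (128 / p ^ 2 + 1) * (lm + m₀ * Real.exp (-(p / 2 * t))) * E t := by
  intro T hT
  have hp := h.p_pos
  have hlm := h.lm_pos
  have hm₀ : 0 ≤ m₀ := hl₀.trans hlm₀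
  -- Half the damping, Ap/2, must absorb 64/p from the forcing by V, the other half being spent on
  -- the decay of the barrier. The summand 1 gives A ≥ 1 for the initial time and pays for p/2 · lm.
  set A : ℝ := 128 / p ^ 2 + 1 with hA
  have hA1 : 1 ≤ A := by
    have : 0 ≤ 128 / p ^ 2 := by positivity
    linarith
  have := nonpos_of_deriv_neg (T := T)
    (f := fun s => M s - A * (lm + m₀ * Real.exp (-(p / 2 * s))) * E s)
    (f' := fun s => M' s - (A * (m₀ * (-(p / 2) * Real.exp (-(p / 2 * s)))) * E s
      + A * (lm + m₀ * Real.exp (-(p / 2 * s))) * E' s))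
    (fun s hs => (hM s hs).sub (((((hasDerivAt_exp_neg_mul p s).const_mul m₀).const_add
      lm).const_mul A).hasDerivWithinAt.mul (hE s hs)))
    (by
      have hE0 := hEpos 0 le_rfl
      have : m₀ ≤ A * (lm + m₀) := by nlinarith
      have := mul_le_mul_of_nonneg_right this hE0.le
      simp only [mul_zero, neg_zero, Real.exp_zero, mul_one]
      linarith) ?_ T ⟨hT, le_rfl⟩
  · simpa using this
  intro s hs hs0
  have hEs := hEpos s hs.1
  set x := Real.exp (-(p / 2 * s)) with hx
  have hx0 : 0 < x := Real.exp_pos _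
  have hH0 : 0 ≤ A * (lm + m₀ * x) := by positivity
  have hMs : M s = A * (lm + m₀ * x) * E s := by simpa [sub_eq_zero] using hs0
  have e0 := envelope_nonneg hl₀ h.p_pos h.lm_pos.le hs.1
  have e1 := envelope_le hl h.p_pos h.lm_le hs.1
  have e2 : envelope p lm l₀ s ≤ lm + m₀ * x := by
    unfold envelope; rw [← hx]; nlinarith
  set k := √(envelope p lm l₀ s) with hkdef
  set l := √(A * (lm + m₀ * x)) with hldef
  have hk0 : 0 ≤ k := Real.sqrt_nonneg _
  have hl0 : 0 ≤ l := Real.sqrt_nonneg _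
  have hk : k ^ 2 = envelope p lm l₀ s := Real.sq_sqrt e0
  have hl2 : l ^ 2 = A * (lm + m₀ * x) := Real.sq_sqrt hH0
  set r := √(E s) with hr
  have hr0 : 0 ≤ r := Real.sqrt_nonneg _
  have hE2 : r * r = E s := Real.mul_self_sqrt hEs.le
  have hsqrtV : √(V s) ≤ k * r := by
    rw [hkdef, hr, ← Real.sqrt_mul e0]; exact Real.sqrt_le_sqrt (hVE s hs.1)
  have hsqrtM : √(M s) = l * r := by rw [hMs, Real.sqrt_mul hH0]
  have hδ := h.delta_nonneg
  have b1 : M' s ≤ 2 * (-p + q + 2 * δ) * l ^ 2 * E s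
      + 2 * l * (2 * k + 2 * δ + 2 * δ * k) * E s := by
    refine (hM' s hs.1).trans ?_
    rw [hsqrtM, hMs, hl2, mul_assoc (2 * (-p + q + 2 * δ))]
    refine add_le_add le_rfl ?_
    calc _ ≤ 2 * (l * r) * (2 * (k * r) + 2 * δ * r + 2 * δ * (k * r)) := by gcongr
      _ = _ := by rw [← hE2]; ring
  have b2 : 4 * q * E s - 4 * δ * E s - 8 * δ * k * E s ≤ E' s := by
    have := mul_le_mul_of_nonneg_left hsqrtV (show 0 ≤ 8 * δ * r by positivity)
    have c2 : 8 * δ * r * (k * r) = 8 * δ * k * E s := by rw [← hE2]; ring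
    linarith [hE' s hs.1]
  have b3 := mul_lt_mul_of_pos_right (h.deviation_barrier hk0 hl0 (hk.trans_le e1)) hEs
  have b5 := mul_le_mul_of_nonneg_left b2 (sq_nonneg l)
  have key : -p * l ^ 2 + 64 * k ^ 2 / p + p / 2 * lm + A * (m₀ * (p / 2 * x)) ≤ 0 := by
    have hAp : A * p = 128 / p + p := by rw [hA]; field_simp
    have c : 64 * k ^ 2 / p ≤ 64 / p * (lm + m₀ * x) := by
      rw [hk, mul_div_right_comm]; gcongr
    have c1 : 0 ≤ 64 / p * lm := by positivity
    have c2 : 0 ≤ p / 2 * (m₀ * x) := by positivity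
    have c3 : 0 ≤ p / 2 * lm := by positivity
    have c4 : -p * l ^ 2 + A * (m₀ * (p / 2 * x))
        = -((A * p) * lm) - 1 / 2 * (A * p) * (m₀ * x) := by rw [hl2]; ring
    have c5 : (128 / p + p) * lm = 2 * (64 / p * lm) + 2 * (p / 2 * lm) := by ring
    have c6 : 1 / 2 * (128 / p + p) * (m₀ * x) = 64 / p * (m₀ * x) + p / 2 * (m₀ * x) := by ring
    rw [hAp, c5, c6] at c4
    linarith
  have b6 := mul_le_mul_of_nonneg_right key hEs.le
  simp only [← hl2]
  linarith

end Scalar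

end Opinion

namespace Opinion

open Set
open scoped RealInnerProductSpace

/-! ### From solutions of the system to the scalar inequalities. -/

section Derivatives

variable {d m n : ℕ} {x v : ℝ → Config d m} {y w : ℝ → Config d n} {t : ℝ}

lemma hasDerivWithinAt_mean
    (hx : ∀ i, HasDerivWithinAt (fun s => x s i) (v t i) (Ici 0) t) :
    HasDerivWithinAt (fun s => mean (x s)) (mean (v t)) (Ici 0) t :=
  (HasDerivWithinAt.fun_sum fun i _ => hx i).const_smul (1 / (m : ℝ))

lemma hasDerivWithinAt_dev_sq
    (hx : ∀ i, HasDerivWithinAt (fun s => x s i) (v t i) (Ici 0) t) (i : Fin m) :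
    HasDerivWithinAt (fun s => ‖dev (x s) i‖ ^ 2) (2 * ⟪dev (x t) i, dev (v t) i⟫) (Ici 0) t :=
  ((hx i).sub (hasDerivWithinAt_mean hx)).norm_sq

lemma hasDerivWithinAt_variance (hm : 0 < m)
    (hx : ∀ i, HasDerivWithinAt (fun s => x s i) (v t i) (Ici 0) t) :
    HasDerivWithinAt (fun s => variance (x s))
      (2 * ((1 / (m : ℝ)) * ∑ i, ⟪dev (x t) i, v t i⟫)) (Ici 0) t := by
  have h := (HasDerivWithinAt.fun_sum fun i (_ : i ∈ Finset.univ) =>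
    hasDerivWithinAt_dev_sq hx i).const_mul (1 / (m : ℝ))
  refine h.congr_deriv ?_
  have : ∑ i, ⟪dev (x t) i, mean (v t)⟫ = 0 := by
    rw [← sum_inner, sum_dev hm, inner_zero_left]
  rw [← Finset.mul_sum]
  simp only [dev] at this ⊢
  simp only [inner_sub_right _ (v t _), Finset.sum_sub_distrib, this]
  ring

lemma hasDerivWithinAt_gap_sq
    (hx : ∀ i, HasDerivWithinAt (fun s => x s i) (v t i) (Ici 0) t)
    (hy : ∀ j, HasDerivWithinAt (fun s => y s j) (w t j) (Ici 0) t) :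
    HasDerivWithinAt (fun s => ‖mean (x s) - mean (y s)‖ ^ 2)
      (2 * ⟪mean (x t) - mean (y t), mean (v t) - mean (w t)⟫) (Ici 0) t :=
  ((hasDerivWithinAt_mean hx).sub (hasDerivWithinAt_mean hy)).norm_sq

end Derivatives

section Estimates

variable {d m n : ℕ} {p q ε δ : ℝ} {α : Fin m → Fin m → ℝ} {β : Fin n → Fin n → ℝ}
  {γ : Fin m → Fin n → ℝ}

lemma variance_nonneg (x : Config d m) : 0 ≤ variance x := by
  rw [← rms_dev_sq]; positivity

lemma rms_dev_le_sqrt (x : Config d m) (y : Config d n) :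
    rms (dev x) ≤ √(variance x + variance y) :=
  Real.sqrt_le_sqrt (le_add_of_nonneg_right (variance_nonneg y))

lemma rms_dev_le_sqrt' (x : Config d m) (y : Config d n) :
    rms (dev y) ≤ √(variance x + variance y) :=
  Real.sqrt_le_sqrt (le_add_of_nonneg_left (variance_nonneg x))

lemma energy_deriv_le (hm : 0 < m) (hn : 0 < n) (hε : 0 ≤ ε) (hδ : 0 ≤ δ)
    (hx : SmallNoise ε δ α γ) (hy : SmallNoise ε δ β fun j i => γ i j)
    (x : Config d m) (y : Config d n) :
    2 * ((1 / (m : ℝ)) * ∑ i, ⟪dev x i, drift p q α γ x y i⟫)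
      + 2 * ((1 / (n : ℝ)) * ∑ j, ⟪dev y j, drift p q β (fun j i => γ i j) y x j⟫)
      ≤ 2 * (-p + q + 2 * ε + 2 * δ) * (variance x + variance y)
        + 4 * δ * ‖mean x - mean y‖ * √(variance x + variance y) := by
  have h1 := sum_inner_drift_le (p := p) (q := q) hm hn hδ hx x y
  have h2 := sum_inner_drift_le (p := p) (q := q) hn hm hδ hy y x
  rw [norm_sub_rev] at h2
  have hD : 0 ≤ δ * ‖mean x - mean y‖ := by positivity
  have h3 := mul_le_mul_of_nonneg_left (rms_dev_le_sqrt x y) hD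
  have h4 := mul_le_mul_of_nonneg_left (rms_dev_le_sqrt' x y) hD
  -- Turns the two cross terms in ε into another ε(var x + var y), whence 2ε.
  have h5 := mul_nonneg hε (sq_nonneg (rms (dev x) - rms (dev y)))
  rw [← rms_dev_sq x, ← rms_dev_sq y] at *
  linarith

lemma gap_deriv_ge (hm : 0 < m) (hn : 0 < n) (hδ : 0 ≤ δ)
    (hx : SmallNoise ε δ α γ) (hy : SmallNoise ε δ β fun j i => γ i j)
    (x : Config d m) (y : Config d n) :
    4 * q * ‖mean x - mean y‖ ^ 2 - 4 * δ * ‖mean x - mean y‖ ^ 2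
      - 8 * δ * ‖mean x - mean y‖ * √(variance x + variance y)
      ≤ 2 * ⟪mean x - mean y, mean (drift p q α γ x y)
        - mean (drift p q β (fun j i => γ i j) y x)⟫ := by
  have h1 := norm_mean_drift_sub_le (p := p) (q := q) hm hn hδ hx x y
  have h2 := norm_mean_drift_sub_le (p := p) (q := q) hn hm hδ hy y x
  rw [norm_sub_rev (mean y) (mean x)] at h2
  change ‖mean (drift p q α γ x y) - q • (mean x - mean y)‖ ≤ _ at h1
  change ‖mean (drift p q β (fun j i => γ i j) y x) - q • (mean y - mean x)‖ ≤ _ at h2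
  set D := mean x - mean y with hD
  set R₁ := mean (drift p q α γ x y) - q • D with hR₁
  set R₂ := mean (drift p q β (fun j i => γ i j) y x) - q • (mean y - mean x) with hR₂
  have e : mean (drift p q α γ x y) - mean (drift p q β (fun j i => γ i j) y x)
      = (2 * q) • D + (R₁ - R₂) := by
    rw [hR₁, hR₂, hD]; module
  rw [e, inner_add_right, inner_smul_right, real_inner_self_eq_norm_sq]
  have h3 := neg_le_of_abs_le (abs_real_inner_le_norm D (R₁ - R₂))
  have h4 := mul_le_mul_of_nonneg_left ((norm_sub_le R₁ R₂).trans (add_le_add h1 h2))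
    (norm_nonneg D)
  have hD0 : 0 ≤ δ * ‖D‖ := by positivity
  have h5 := mul_le_mul_of_nonneg_left (rms_dev_le_sqrt x y) hD0
  have h6 := mul_le_mul_of_nonneg_left (rms_dev_le_sqrt' x y) hD0
  nlinarith

lemma deviation_deriv_le (hm : 0 < m) (hn : 0 < n) (hδ : 0 ≤ δ) (hx : SmallNoise ε δ α γ)
    (x : Config d m) (y : Config d n) (i : Fin m) :
    2 * ⟪dev x i, dev (drift p q α γ x y) i⟫ ≤ 2 * (-p + q + 2 * δ) * ‖dev x i‖ ^ 2
      + 2 * ‖dev x i‖ * (2 * √(variance x + variance y) + 2 * δ * ‖mean x - mean y‖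
        + 2 * δ * √(variance x + variance y)) := by
  have h := inner_drift_sub_le (p := p) (q := q) hm hn hδ hx x y i
  have h1 := rms_dev_le_sqrt x y
  have h2 := rms_dev_le_sqrt' x y
  have h3 : rms (dev x) + rms (dev y)
        + δ * (2 * ‖mean x - mean y‖ + rms (dev x) + rms (dev y))
      ≤ 2 * √(variance x + variance y) + 2 * δ * ‖mean x - mean y‖
        + 2 * δ * √(variance x + variance y) := by
    nlinarith
  have h4 := mul_le_mul_of_nonneg_left h3 (norm_nonneg (dev x i))
  change ⟪dev x i, dev (drift p q α γ x y) i⟫ ≤ _ at h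
  linarith

lemma maxDev_le {x : Config d m} (hm : 0 < m) {c : ℝ} (h : ∀ i, ‖dev x i‖ ^ 2 ≤ c) :
    maxDev x ≤ c :=
  haveI : Nonempty (Fin m) := ⟨⟨0, hm⟩⟩
  ciSup_le h

lemma dev_sq_le_maxDev (x : Config d m) (i : Fin m) : ‖dev x i‖ ^ 2 ≤ maxDev x :=
  le_ciSup (f := fun i => ‖dev x i‖ ^ 2) (finite_range _).bddAbove i

lemma maxDev_nonneg (x : Config d m) : 0 ≤ maxDev x :=
  Real.iSup_nonneg fun _ => sq_nonneg _

lemma variance_le_maxDev (hm : 0 < m) (x : Config d m) : variance x ≤ maxDev x := by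
  have hm' : (0 : ℝ) < m := by positivity
  unfold variance
  rw [one_div, inv_mul_le_iff₀ hm']
  simpa using Finset.sum_le_sum fun i (_ : i ∈ Finset.univ) => dev_sq_le_maxDev x i

end Estimates

lemma IsSolution.hasDerivWithinAt_drift {d N₁ N₂ : ℕ} {ω : Network N₁ N₂}
    {x : ℝ → Config d N₁} {y : ℝ → Config d N₂} (h : IsSolution ω x y) (p q : ℝ)
    {t : ℝ} (ht : 0 ≤ t) :
    (∀ i, HasDerivWithinAt (fun s => x s i)
      (drift p q (fun i i' => alignX ω i i' - p) (fun i j => anti ω i j - q) (x t) (y t) i)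
      (Ici 0) t) ∧
    (∀ j, HasDerivWithinAt (fun s => y s j)
      (drift p q (fun j j' => alignY ω j j' - p) (fun j i => anti ω i j - q) (y t) (x t) j)
      (Ici 0) t) := by
  constructor
  · intro i
    refine (h.1 t ht i).congr_deriv ?_
    simp only [drift, add_sub_cancel]
    -- `drift` sums over all members; the diagonal term vanishes because its displacement is zero.
    rw [Finset.sum_filter_of_ne]
    rintro i' - h0 rfl
    simp at h0
  · intro j
    refine (h.2 t ht j).congr_deriv ?_
    simp only [drift, add_sub_cancel]
    rw [Finset.sum_filter_of_ne]
    rintro j' - h0 rfl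
    simp at h0

/-- Separation holds for every network whose coefficients fluctuate little. -/
theorem separates_of_smallNoise {N₁ N₂ : ℕ} (hm : 0 < N₁) (hn : 0 < N₂) {p q ε δ lm lp : ℝ}
    (hε : 0 ≤ ε) (h : Thresholds p q ε δ lm lp) {ω : Network N₁ N₂}
    (hx : SmallNoise ε δ (fun i i' => alignX ω i i' - p) (fun i j => anti ω i j - q))
    (hy : SmallNoise ε δ (fun j j' => alignY ω j j' - p) (fun j i => anti ω i j - q)) :
    Separates ω lm lp (p / 2) (2 * (128 / p ^ 2 + 1)) := by
  intro d x y hsol hne hratio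
  have hδ := h.delta_nonneg
  have hD := fun t ht => hsol.hasDerivWithinAt_drift p q (t := t) ht
  have hE := fun t ht => hasDerivWithinAt_gap_sq (v := fun t => drift p q _ _ (x t) (y t))
    (w := fun t => drift p q _ _ (y t) (x t)) (hD t ht).1 (hD t ht).2
  have hV := fun t ht => (hasDerivWithinAt_variance (v := fun t => drift p q _ _ (x t) (y t)) hm
    (hD t ht).1).add (hasDerivWithinAt_variance (v := fun t => drift p q _ _ (y t) (x t)) hn
    (hD t ht).2)
  have hgap0 : 0 < ‖mean (x 0) - mean (y 0)‖ ^ 2 :=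
    pow_pos (norm_pos_iff.2 (sub_ne_zero.2 hne)) 2
  have hl₀ : 0 ≤ ratio (x 0) (y 0) :=
    div_nonneg (add_nonneg (variance_nonneg _) (variance_nonneg _)) hgap0.le
  have hE' := fun t (_ : (0 : ℝ) ≤ t) => gap_deriv_ge (p := p) (q := q) hm hn hδ hx hy (x t) (y t)
  have hsqrt : ∀ t, √(‖mean (x t) - mean (y t)‖ ^ 2) = ‖mean (x t) - mean (y t)‖ :=
    fun t => Real.sqrt_sq (norm_nonneg _)
  have main := h.energy_le (V := fun t => variance (x t) + variance (y t))
    (E := fun t => ‖mean (x t) - mean (y t)‖ ^ 2) hratio hl₀ (fun t => sq_nonneg _) hV hE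
    (fun t _ => by
      simpa only [hsqrt] using energy_deriv_le (p := p) (q := q) hm hn hε hδ hx hy (x t) (y t))
    (fun t ht => by simpa only [hsqrt] using hE' t ht)
    (by rw [ratio, div_mul_cancel₀ _ hgap0.ne']) hgap0
  set m₀ := maxRatio (x 0) (y 0) with hm₀
  have hlm₀ : ratio (x 0) (y 0) ≤ m₀ := by
    unfold ratio; rw [hm₀, maxRatio]
    gcongr
    · exact variance_le_maxDev hm _
    · exact variance_le_maxDev hn _
  have hmax : m₀ * ‖mean (x 0) - mean (y 0)‖ ^ 2 = maxDev (x 0) + maxDev (y 0) := by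
    rw [hm₀, maxRatio, div_mul_cancel₀ _ hgap0.ne']
  have devx := fun i => h.deviation_le (M := fun t => ‖dev (x t) i‖ ^ 2) hratio hl₀ hlm₀
    (fun t ht => (main t ht).1) (fun t ht => (main t ht).2) hE
    (fun t ht => by simpa only [hsqrt] using hE' t ht)
    (fun t ht => hasDerivWithinAt_dev_sq (v := fun t => drift p q _ _ (x t) (y t)) (hD t ht).1 i)
    (fun t _ => by
      simpa only [hsqrt, Real.sqrt_sq (norm_nonneg _)] using
        deviation_deriv_le (p := p) (q := q) hm hn hδ hx (x t) (y t) i)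
    (by
      rw [hmax]; exact (dev_sq_le_maxDev _ _).trans (le_add_of_nonneg_right (maxDev_nonneg _)))
  have devy := fun j => h.deviation_le (M := fun t => ‖dev (y t) j‖ ^ 2) hratio hl₀ hlm₀
    (fun t ht => (main t ht).1) (fun t ht => (main t ht).2) hE
    (fun t ht => by simpa only [hsqrt] using hE' t ht)
    (fun t ht => hasDerivWithinAt_dev_sq (v := fun t => drift p q _ _ (y t) (x t)) (hD t ht).2 j)
    (fun t _ => by
      have := deviation_deriv_le (p := p) (q := q) hn hm hδ hy (y t) (x t) j
      rw [norm_sub_rev (mean (y t)), add_comm (variance (y t))] at this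
      simpa only [hsqrt, Real.sqrt_sq (norm_nonneg _)] using this)
    (by
      rw [hmax]; exact (dev_sq_le_maxDev _ _).trans (le_add_of_nonneg_left (maxDev_nonneg _)))
  intro t ht
  obtain ⟨hpos, hle⟩ := main t ht
  refine ⟨fun heq => by simp [heq] at hpos, ?_, ?_⟩
  · rw [ratio, div_le_iff₀ hpos]
    exact hle
  · rw [maxRatio, div_le_iff₀ hpos]
    -- Both maxima obey the same bound, hence the factor 2 in K.
    refine (add_le_add (maxDev_le hm fun i => devx i t ht)
      (maxDev_le hn fun j => devy j t ht)).trans (le_of_eq ?_)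
    ring

end Opinion

namespace Opinion

/-! ### Probability of small noise. -/

section GoodEvent

variable {p q : unitInterval} {N₁ N₂ : ℕ}

/-- The pair s(i, j) recurs only if i = l and j = k; then s(i, l) is diagonal and occurs once. -/
lemma spread_sym2 {n : ℕ} {f : Sym2 (Fin n) → Link N₁ N₂} (hf : Function.Injective f) :
    Spread fun i j : Fin n => f s(i, j) := by
  intro i k j l hik hjl
  simp only [List.mem_cons, hf.eq_iff, Sym2.eq_iff, List.not_mem_nil, or_false]
  grind

lemma spread_prod : Spread fun (i : Fin N₁) (j : Fin N₂) =>
    (Sum.inr (Sum.inr (i, j)) : Link N₁ N₂) := by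
  intro i k j l hik hjl
  left
  simp [hik, hjl]

/-- The realizations with small row sums and small Gram matrices. -/
def goodEvent (p q : unitInterval) (N₁ N₂ : ℕ) (ε δ : ℝ) : Set (Network N₁ N₂) :=
  {ω | (∀ i : Fin N₁, |∑ i', noise p q (Sum.inl s(i, i')) ω| < δ * N₁) ∧
    (∀ j : Fin N₂, |∑ j', noise p q (Sum.inr (Sum.inl s(j, j'))) ω| < δ * N₂) ∧
    (∀ i : Fin N₁, |∑ j : Fin N₂, noise p q (Sum.inr (Sum.inr (i, j))) ω| < δ * N₂) ∧
    (∀ j : Fin N₂, |∑ i : Fin N₁, noise p q (Sum.inr (Sum.inr (i, j))) ω| < δ * N₁) ∧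
    gramSq (fun i i' : Fin N₁ => noise p q (Sum.inl s(i, i')) ω) < ε ^ 4 * (N₁ * N₁) ^ 2 ∧
    gramSq (fun j j' : Fin N₂ => noise p q (Sum.inr (Sum.inl s(j, j'))) ω)
      < ε ^ 4 * (N₂ * N₂) ^ 2 ∧
    gramSq (fun (i : Fin N₁) (j : Fin N₂) => noise p q (Sum.inr (Sum.inr (i, j))) ω)
      < ε ^ 4 * (N₁ * N₂) ^ 2}

lemma smallNoise_left_of_mem_goodEvent (hm : 0 < N₁) (hn : 0 < N₂) {ε δ : ℝ} (hε : 0 ≤ ε)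
    {ω : Network N₁ N₂} (h : ω ∈ goodEvent p q N₁ N₂ ε δ) :
    SmallNoise ε δ (fun i i' => alignX ω i i' - p) (fun i j => anti ω i j - q) where
  symm i i' := by simp [alignX, Sym2.eq_swap]
  abs_align_le i i' := abs_noise_le_one (p := p) (q := q) (Sum.inl s(i, i')) ω
  abs_anti_le i j := abs_noise_le_one (p := p) (q := q) (Sum.inr (Sum.inr (i, j))) ω
  row_align i := (h.1 i).le
  row_anti i := (h.2.2.1 i).le
  col_anti j := (h.2.2.2.1 j).le
  form_align u w := bilinear_le hm hm hε h.2.2.2.2.1.le u w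
  form_anti u w := bilinear_le hm hn hε h.2.2.2.2.2.2.le u w

lemma smallNoise_right_of_mem_goodEvent (hm : 0 < N₁) (hn : 0 < N₂) {ε δ : ℝ} (hε : 0 ≤ ε)
    {ω : Network N₁ N₂} (h : ω ∈ goodEvent p q N₁ N₂ ε δ) :
    SmallNoise ε δ (fun j j' => alignY ω j j' - p) (fun j i => anti ω i j - q) where
  symm j j' := by simp [alignY, Sym2.eq_swap]
  abs_align_le j j' := abs_noise_le_one (p := p) (q := q) (Sum.inr (Sum.inl s(j, j'))) ω
  abs_anti_le j i := abs_noise_le_one (p := p) (q := q) (Sum.inr (Sum.inr (i, j))) ω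
  row_align j := (h.2.1 j).le
  row_anti j := (h.2.2.2.1 j).le
  col_anti i := (h.2.2.1 i).le
  form_align u w := bilinear_le hn hn hε h.2.2.2.2.2.1.le u w
  -- The bound for the transposed matrix follows from the original one by exchanging the arguments.
  form_anti u w := by
    have := bilinear_le hm hn hε h.2.2.2.2.2.2.le w u
    rw [mul_comm (N₂ : ℝ), mul_comm (rms u), Finset.sum_comm]
    refine le_of_eq_of_le (congrArg _ ?_) this
    exact Finset.sum_congr rfl fun i _ => Finset.sum_congr rfl fun j _ => by
      rw [real_inner_comm]; rfl

/-- Union bound: four families of row or column sums contribute 4(N₁ + N₂) exponentials, and three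
Gram matrices at most 2/N each, up to 1/ε⁴. -/
lemma measureReal_compl_goodEvent_le (hm : 0 < N₁) (hn : 0 < N₂) {ε δ : ℝ} (hε : 0 < ε)
    (hδ : 0 ≤ δ) :
    (networkLaw p q N₁ N₂).real (goodEvent p q N₁ N₂ ε δ)ᶜ
      ≤ 4 * (N₁ + N₂) * Real.exp (-(2 * δ ^ 2 * (min N₁ N₂ : ℕ)))
        + 6 / (min N₁ N₂ : ℕ) / ε ^ 4 := by
  set P := networkLaw p q N₁ N₂ with hP
  set N := min N₁ N₂ with hN
  have hN0 : (0 : ℝ) < N := by exact_mod_cast lt_min hm hn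
  have hN₁ : (N : ℝ) ≤ N₁ := by exact_mod_cast min_le_left _ _
  have hN₂ : (N : ℝ) ≤ N₂ := by exact_mod_cast min_le_right _ _
  have r₁ := row_sum_ge_le (p := p) (q := q)
    (fun i i' : Fin N₁ => (Sum.inl s(i, i') : Link N₁ N₂)) (fun i a b hab => by simp at hab; grind) hδ
  have r₂ := row_sum_ge_le (p := p) (q := q)
    (fun j j' : Fin N₂ => (Sum.inr (Sum.inl s(j, j')) : Link N₁ N₂))
    (fun i a b hab => by simp at hab; grind) hδ
  have r₃ := row_sum_ge_le (p := p) (q := q)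
    (fun (i : Fin N₁) (j : Fin N₂) => (Sum.inr (Sum.inr (i, j)) : Link N₁ N₂))
    (fun i a b hab => by simpa using hab) hδ
  have r₄ := row_sum_ge_le (p := p) (q := q)
    (fun (j : Fin N₂) (i : Fin N₁) => (Sum.inr (Sum.inr (i, j)) : Link N₁ N₂))
    (fun i a b hab => by simpa using hab) hδ
  have g₁ := gramSq_gt_le (p := p) (q := q) hm hm
    (spread_sym2 (N₁ := N₁) (N₂ := N₂) Sum.inl_injective) hε
  have g₂ := gramSq_gt_le (p := p) (q := q) hn hn
    (spread_sym2 (N₁ := N₁) (N₂ := N₂) (Sum.inr_injective.comp Sum.inl_injective)) hε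
  have g₃ := gramSq_gt_le (p := p) (q := q) hm hn (spread_prod (N₁ := N₁) (N₂ := N₂)) hε
  have hsub : (goodEvent p q N₁ N₂ ε δ)ᶜ ⊆
      {ω | ∃ i : Fin N₁, δ * N₁ ≤ |∑ i', noise p q (Sum.inl s(i, i')) ω|} ∪
      ({ω | ∃ j : Fin N₂, δ * N₂ ≤ |∑ j', noise p q (Sum.inr (Sum.inl s(j, j'))) ω|} ∪
      ({ω | ∃ i : Fin N₁, δ * N₂ ≤ |∑ j : Fin N₂, noise p q (Sum.inr (Sum.inr (i, j))) ω|} ∪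
      ({ω | ∃ j : Fin N₂, δ * N₁ ≤ |∑ i : Fin N₁, noise p q (Sum.inr (Sum.inr (i, j))) ω|} ∪
      ({ω | ε ^ 4 * (N₁ * N₁) ^ 2
          ≤ gramSq (fun i i' : Fin N₁ => noise p q (Sum.inl s(i, i')) ω)} ∪
      ({ω | ε ^ 4 * (N₂ * N₂) ^ 2
          ≤ gramSq (fun j j' : Fin N₂ => noise p q (Sum.inr (Sum.inl s(j, j'))) ω)} ∪
      {ω | ε ^ 4 * (N₁ * N₂) ^ 2
          ≤ gramSq (fun (i : Fin N₁) (j : Fin N₂) =>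
            noise p q (Sum.inr (Sum.inr (i, j))) ω)}))))) := by
    intro ω hω
    simp only [goodEvent, Set.mem_compl_iff, Set.mem_ofPred_eq, not_and_or, not_forall, not_lt] at hω
    exact hω
  have e : ∀ {M : ℕ}, (N : ℝ) ≤ M →
      Real.exp (-(2 * δ ^ 2 * M)) ≤ Real.exp (-(2 * δ ^ 2 * N)) := by
    intro M hM; gcongr
  have i₁ : 1 / (N₁ : ℝ) ≤ 1 / N := one_div_le_one_div_of_le hN0 hN₁
  have i₂ : 1 / (N₂ : ℝ) ≤ 1 / N := one_div_le_one_div_of_le hN0 hN₂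
  have hε4 : 0 < ε ^ 4 := by positivity
  have g₁' := g₁.trans (div_le_div_of_nonneg_right (add_le_add i₁ i₁) hε4.le)
  have g₂' := g₂.trans (div_le_div_of_nonneg_right (add_le_add i₂ i₂) hε4.le)
  have g₃' := g₃.trans (div_le_div_of_nonneg_right (add_le_add i₁ i₂) hε4.le)
  have r₁' := r₁.trans (mul_le_mul_of_nonneg_left
    (mul_le_mul_of_nonneg_left (e hN₁) zero_le_two) (Nat.cast_nonneg _))
  have r₂' := r₂.trans (mul_le_mul_of_nonneg_left
    (mul_le_mul_of_nonneg_left (e hN₂) zero_le_two) (Nat.cast_nonneg _))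
  have r₃' := r₃.trans (mul_le_mul_of_nonneg_left
    (mul_le_mul_of_nonneg_left (e hN₂) zero_le_two) (Nat.cast_nonneg _))
  have r₄' := r₄.trans (mul_le_mul_of_nonneg_left
    (mul_le_mul_of_nonneg_left (e hN₁) zero_le_two) (Nat.cast_nonneg _))
  refine (measureReal_mono hsub).trans ?_
  refine (measureReal_union_le _ _).trans <| (add_le_add r₁' <|
    (measureReal_union_le _ _).trans <| add_le_add r₂' <|
    (measureReal_union_le _ _).trans <| add_le_add r₃' <|
    (measureReal_union_le _ _).trans <| add_le_add r₄' <|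
    (measureReal_union_le _ _).trans <| add_le_add g₁' <|
    (measureReal_union_le _ _).trans <| add_le_add g₂' g₃').trans (le_of_eq ?_)
  ring

lemma measureReal_separates_ge (hm : 0 < N₁) (hn : 0 < N₂) {ε δ lm lp : ℝ} (hε : 0 < ε)
    (h : Thresholds p q ε δ lm lp) :
    1 - (4 * (N₁ + N₂) * Real.exp (-(2 * δ ^ 2 * (min N₁ N₂ : ℕ)))
        + 6 / (min N₁ N₂ : ℕ) / ε ^ 4)
      ≤ (networkLaw p q N₁ N₂).real
          {ω | Separates ω lm lp ((p : ℝ) / 2) (2 * (128 / (p : ℝ) ^ 2 + 1))} := by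
  have hc := measureReal_compl_goodEvent_le (p := p) (q := q) hm hn hε h.delta_nonneg
  rw [probReal_compl_eq_one_sub (Set.toFinite _).measurableSet] at hc
  have hsub : goodEvent p q N₁ N₂ ε δ ⊆
      {ω | Separates ω lm lp ((p : ℝ) / 2) (2 * (128 / (p : ℝ) ^ 2 + 1))} := fun ω hω =>
    separates_of_smallNoise hm hn hε.le h (smallNoise_left_of_mem_goodEvent hm hn hε.le hω)
      (smallNoise_right_of_mem_goodEvent hm hn hε.le hω)
  have := measureReal_mono (μ := networkLaw p q N₁ N₂) hsub
  linarith

end GoodEvent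

/-! ### Choice of the thresholds and limit of the probability. -/

section Asymptotics

/-- The source of both C(p,q,α) and c(p,q,α): the thresholds themselves do not involve α. -/
lemma log_sq_le_rpow {α : ℝ} (hα : 0 < α) {N : ℕ} :
    Real.log N ^ 2 ≤ 4 / α ^ 2 * (N : ℝ) ^ α := by
  rcases Nat.eq_zero_or_pos N with rfl | hN
  · simp; positivity
  have h := Real.log_le_rpow_div (Nat.cast_nonneg N) (half_pos hα)
  have h0 : 0 ≤ Real.log N := Real.log_natCast_nonneg N
  calc Real.log N ^ 2 ≤ ((N : ℝ) ^ (α / 2) / (α / 2)) ^ 2 := by gcongr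
    _ = _ := by
      rw [div_pow, ← Real.rpow_natCast, ← Real.rpow_mul (Nat.cast_nonneg N)]
      push_cast
      rw [div_mul_cancel₀ _ two_ne_zero]
      field_simp; norm_num

lemma log_sq_div_le {α : ℝ} (hα : 0 < α) {N : ℕ} (hN : 0 < N) :
    Real.log N ^ 2 / N ≤ 4 / α ^ 2 / (N : ℝ) ^ (1 - α) := by
  have hN' : (0 : ℝ) < N := by exact_mod_cast hN
  rw [Real.rpow_sub hN', Real.rpow_one, div_div_eq_mul_div]
  gcongr
  exact log_sq_le_rpow hα

lemma le_div_log_sq {α : ℝ} (hα : 0 < α) {N : ℕ} (hN : 2 ≤ N) :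
    α ^ 2 / 4 * (N : ℝ) ^ (1 - α) ≤ N / Real.log N ^ 2 := by
  have hN' : (0 : ℝ) < N := by positivity
  have hlog : 0 < Real.log N := Real.log_pos (by exact_mod_cast hN)
  have h := log_sq_div_le hα (N := N) (by omega)
  have hpow : 0 < (N : ℝ) ^ (1 - α) := by positivity
  have := one_div_le_one_div_of_le (by positivity) h
  rw [one_div_div, one_div_div] at this
  refine le_trans (le_of_eq ?_) this
  field_simp

lemma tendsto_log_sq_div : Tendsto (fun N : ℕ => Real.log N ^ 2 / N) atTop (𝓝 0) :=
  ((Real.isLittleO_pow_log_id_atTop (n := 2)).tendsto_div_nhds_zero).comp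
    tendsto_natCast_atTop_atTop

/-- With u = log N the expression is exp(-u(cu - 1)). The logarithm in δ is there to beat the number
of rows. -/
lemma tendsto_mul_exp_neg_log_sq {c : ℝ} (hc : 0 < c) :
    Tendsto (fun N : ℕ => (N : ℝ) * Real.exp (-(c * Real.log N ^ 2))) atTop (𝓝 0) := by
  have h1 : Tendsto (fun u : ℝ => u * (c * u - 1)) atTop atTop :=
    tendsto_id.atTop_mul_atTop₀
      (tendsto_atTop_add_const_right _ _ (tendsto_id.const_mul_atTop hc))
  have h2 : Tendsto (fun u : ℝ => Real.exp (-(u * (c * u - 1)))) atTop (𝓝 0) :=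
    Real.tendsto_exp_neg_atTop_nhds_zero.comp h1
  have h3 := h2.comp (Real.tendsto_log_atTop.comp tendsto_natCast_atTop_atTop)
  refine h3.congr' ?_
  filter_upwards [eventually_gt_atTop 0] with N hN
  have hN' : (0 : ℝ) < N := by exact_mod_cast hN
  simp only [Function.comp]
  nth_rewrite 3 [← Real.exp_log hN']
  rw [← Real.exp_add]
  congr 1; ring

/-- Comparability is needed to bound the number of rows in the union bound by a multiple of N. -/
lemma add_le_mul_min {κ : ℝ} (hκ : 0 < κ) {n : ℕ × ℕ} (hn : n ∈ Comparable κ) :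
    (n.1 : ℝ) + n.2 ≤ (1 + κ) * (min n.1 n.2 : ℕ) := by
  obtain ⟨h1, h2⟩ := hn
  rw [one_div, inv_mul_le_iff₀ hκ] at h1
  rcases le_total n.1 n.2 with h | h
  · rw [min_eq_left h]; linarith
  · rw [min_eq_right h]; linarith

lemma tendsto_min_atTop : Tendsto (fun n : ℕ × ℕ => min n.1 n.2) atTop atTop := by
  refine tendsto_atTop.2 fun b => ?_
  filter_upwards [eventually_ge_atTop (b, b)] with n hn
  exact le_min hn.1 hn.2

/-- As λ₋λ₊ = 1, the constant 1024 = 64 · 16 makes 64δ²λ₊ = (pq)²/16, within both upper limits. The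
condition λ₋ ≤ 1/3 suffices for δ ≤ p/48. -/
lemma eventually_thresholds {p q : ℝ} (hp₀ : 0 < p) (hp₁ : p ≤ 1) (hq₀ : 0 < q) (hq₁ : q ≤ 1) :
    ∀ᶠ N : ℕ in atTop, Thresholds p q (p / 48) √((p * q) ^ 2 / 1024 * (Real.log N ^ 2 / N))
      (Real.log N ^ 2 / N) (N / Real.log N ^ 2) := by
  have hp2 : p ^ 2 ≤ 1 := pow_le_one₀ hp₀.le hp₁
  have hq2 : q ^ 2 ≤ 1 := pow_le_one₀ hq₀.le hq₁
  have hpq : (p * q) ^ 2 ≤ p ^ 2 := by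
    rw [mul_pow]; exact mul_le_of_le_one_right (sq_nonneg p) hq2
  have hpq' : (p * q) ^ 2 ≤ q ^ 2 := by
    rw [mul_pow]; exact mul_le_of_le_one_left (sq_nonneg q) hp2
  filter_upwards [eventually_ge_atTop 2,
    tendsto_log_sq_div.eventually_le_const (show (0 : ℝ) < 1 / 3 by norm_num)] with N hN hsmall
  have hN' : (0 : ℝ) < N := by positivity
  have hlog : 0 < Real.log N := Real.log_pos (by exact_mod_cast hN)
  have hl : 0 < Real.log N ^ 2 / N := by positivity
  have hinv : Real.log N ^ 2 / N * (N / Real.log N ^ 2) = 1 := by field_simp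
  have hδ := Real.sq_sqrt (show 0 ≤ (p * q) ^ 2 / 1024 * (Real.log N ^ 2 / N) by positivity)
  set lm := Real.log N ^ 2 / N
  set lp := N / Real.log N ^ 2
  set δ := √((p * q) ^ 2 / 1024 * lm)
  have hlp : 1 ≤ lp := by
    by_contra! hc
    nlinarith
  have hp3 := mul_le_mul_of_nonneg_right hpq hl.le
  have hq3 := mul_le_mul_of_nonneg_right hpq' hl.le
  have hp4 := mul_le_mul_of_nonneg_left hsmall (sq_nonneg p)
  have hq4 := mul_le_mul_of_nonneg_left hsmall (sq_nonneg q)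
  have hp5 : 0 < p ^ 2 * lm := by positivity
  have hδlp : 64 * δ ^ 2 * lp = (p * q) ^ 2 / 16 := by
    rw [hδ]; linear_combination (p * q) ^ 2 / 16 * hinv
  refine ⟨hp₀, hp₁, hq₀, le_rfl, Real.sqrt_nonneg _, ?_, ?_, ?_, by linarith, ?_, ?_⟩
  · exact abs_le_of_sq_le_sq' (by nlinarith) (by positivity) |>.2
  · exact abs_le_of_sq_le_sq' (by nlinarith) (by positivity) |>.2
  · rw [hδ]; linarith
  · rw [hδlp]; linarith
  · rw [hδlp]; linarith [sq_nonneg q]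

/-- The probability of separation tends to one. -/
lemma tendsto_measure_separates {p q : unitInterval} (hp₀ : 0 < p) (hq₀ : 0 < q) {κ : ℝ}
    (hκ : 0 < κ) :
    Tendsto (fun n : ℕ × ℕ => networkLaw p q n.1 n.2
      {ω | Separates ω (Real.log (min n.1 n.2 : ℕ) ^ 2 / (min n.1 n.2 : ℕ))
        ((min n.1 n.2 : ℕ) / Real.log (min n.1 n.2 : ℕ) ^ 2) ((p : ℝ) / 2)
        (2 * (128 / (p : ℝ) ^ 2 + 1))})
      (atTop ⊓ 𝓟 (Comparable κ)) (𝓝 1) := by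
  have hp : (0 : ℝ) < p := hp₀
  have hq : (0 : ℝ) < q := hq₀
  set c : ℝ := 2 * (((p : ℝ) * q) ^ 2 / 1024) with hc
  have hc0 : 0 < c := by positivity
  have hmin : Tendsto (fun n : ℕ × ℕ => min n.1 n.2) (atTop ⊓ 𝓟 (Comparable κ)) atTop :=
    tendsto_min_atTop.mono_left inf_le_left
  have hbad : Tendsto (fun N : ℕ => 1 - (4 * (1 + κ) *
      ((N : ℝ) * Real.exp (-(c * Real.log N ^ 2))) + 6 / (N : ℝ) / ((p : ℝ) / 48) ^ 4))
      atTop (𝓝 1) := by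
    have h := ((tendsto_mul_exp_neg_log_sq hc0).const_mul (4 * (1 + κ))).add
      ((tendsto_const_div_atTop_nhds_zero_nat 6).div_const (((p : ℝ) / 48) ^ 4))
    simpa using h.const_sub 1
  suffices h : Tendsto (fun n : ℕ × ℕ => (networkLaw p q n.1 n.2).real
      {ω | Separates ω (Real.log (min n.1 n.2 : ℕ) ^ 2 / (min n.1 n.2 : ℕ))
        ((min n.1 n.2 : ℕ) / Real.log (min n.1 n.2 : ℕ) ^ 2) ((p : ℝ) / 2)
        (2 * (128 / (p : ℝ) ^ 2 + 1))}) (atTop ⊓ 𝓟 (Comparable κ)) (𝓝 1) by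
    simpa using ENNReal.tendsto_ofReal h
  refine tendsto_of_tendsto_of_tendsto_of_le_of_le' (hbad.comp hmin) tendsto_const_nhds ?_
    (Eventually.of_forall fun n => measureReal_le_one)
  filter_upwards [hmin.eventually (eventually_thresholds hp p.2.2 hq q.2.2),
    hmin.eventually_gt_atTop 0,
    (mem_inf_of_right (mem_principal_self _) : Comparable κ ∈ atTop ⊓ 𝓟 (Comparable κ))]
    with n hth hpos hcomp
  refine le_trans ?_ (measureReal_separates_ge (lt_min_iff.1 hpos).1 (lt_min_iff.1 hpos).2
    (by positivity) hth)
  have hN : (0 : ℝ) < (min n.1 n.2 : ℕ) := by exact_mod_cast hpos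
  have hsum := add_le_mul_min hκ hcomp
  simp only [Function.comp]
  rw [Real.sq_sqrt (by positivity)]
  set N : ℝ := ((min n.1 n.2 : ℕ) : ℝ)
  have e : 2 * (((p : ℝ) * q) ^ 2 / 1024 * (Real.log N ^ 2 / N)) * N = c * Real.log N ^ 2 := by
    rw [hc]; field_simp
  rw [e]
  have := mul_le_mul_of_nonneg_right hsum (Real.exp_pos (-(c * Real.log N ^ 2))).le
  linarith

end Asymptotics

end Opinion

theorem theorem1 (p q : unitInterval) (hp₀ : 0 < p) (hp₁ : p < 1) (hq₀ : 0 < q) (hq₁ : q < 1) :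
    -- the constants `C(p,q,α)` and `c(p,q,α)`
    ∃ C c : ℝ → ℝ, (∀ α ∈ Set.Ioo (0 : ℝ) 1, 0 < C α ∧ 0 < c α) ∧
      ∀ κ : ℝ, 0 < κ →
        ∃ (lamMinus lamPlus : ℕ → ℝ) (K : ℝ) (N₀ : ℕ),
          (∀ N : ℕ, N₀ ≤ N →
            0 < lamMinus N ∧
            ∀ α ∈ Set.Ioo (0 : ℝ) 1,
              lamMinus N ≤ C α / (N : ℝ) ^ (1 - α) ∧
              c α * (N : ℝ) ^ (1 - α) ≤ lamPlus N) ∧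
          -- `N₁, N₂ → ∞` jointly, within the comparable pairs
          Tendsto
            (fun n : ℕ × ℕ => Opinion.networkLaw p q n.1 n.2
              {ω | Opinion.Separates ω (lamMinus (min n.1 n.2)) (lamPlus (min n.1 n.2))
                ((p : ℝ) / 2) K})
            (atTop ⊓ 𝓟 (Opinion.Comparable κ)) (𝓝 1) := by
  refine ⟨fun α => 4 / α ^ 2, fun α => α ^ 2 / 4, fun α hα => ?_, fun κ hκ => ?_⟩
  · have := hα.1
    constructor <;> positivity
  -- N₀ = 2 makes log N positive; the witnesses do not depend on κ.
  · refine ⟨fun N => Real.log N ^ 2 / N, fun N => N / Real.log N ^ 2,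
      2 * (128 / (p : ℝ) ^ 2 + 1), 2, fun N hN => ⟨?_, fun α hα => ⟨?_, ?_⟩⟩, ?_⟩
    · have : 0 < Real.log N := Real.log_pos (by exact_mod_cast hN)
      have : (0 : ℝ) < N := by positivity
      positivity
    · exact Opinion.log_sq_div_le hα.1 (by omega)
    · exact Opinion.le_div_log_sq hα.1 hN
    · exact Opinion.tendsto_measure_separates hp₀ hq₀ hκ
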